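/- Let $\overline M$ be a smooth finite-dimensional manifold, possibly with boundary (Hausdorff and second countable), equipped with a locally finite Borel measure $dx$ (for instance the measure of a smooth density), and let $\mathcal I$ be a countable set. Let $L$ be a linear, possibly unbounded operator in $L^2(\overline M)$ with domain $\mathrm{Dom}(L)$ (for instance a pseudo-differential operator with boundary conditions), and let $\{u_\xi\}_{\xi\in\mathcal I}$ be a Riesz basis of $L^2(\overline M)$ (the image of an orthonormal basis under a bounded invertible operator) consisting of eigenfunctions, $u_\xi\in\mathrm{Dom}(L)$, $Lu_\xi=\lambda_\xi u_\xi$. Let $\{v_\xi\}_{\xi\in\mathcal I}$ be the biorthogonal system, $(u_\xi,v_\eta)_{L^2}=\delta_{\xi\eta}$, and assume that it consists of eigenfunctions of the adjoint, $v_\xi\in\mathrm{Dom}(L^*)$, $L^*v_\xi=\overline{\lambda_\xi}\,v_\xi$. Put $$\mathcal F_Lf(\xi)=\int_{\overline M}f(x)\,\overline{v_\xi(x)}\,dx,\qquad C_L^\infty(\overline M)=\bigcap_{k\ge1}\mathrm{Dom}(L^k).$$ Assume that all $u_\xi,v_\xi$ belong to $L^\infty(\overline M)$ and that $$\sup_{\xi\in\mathcal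 I}\frac{\|v_\xi\|_{L^\infty}}{\|u_\xi\|_{L^\infty}}<\infty\quad\text{and}\quad\sup_{\xi\in\mathcal I}\frac{\|u_\xi\|_{L^\infty}}{\|v_\xi\|_{L^\infty}}<\infty .$$ Let $1<p\le2\le q<\infty$. For $\sigma:\mathcal I\to\mathbb C$ put $$W(\sigma)=\sup_{s>0}\,s\Bigl(\sum_{\xi\in\mathcal I,\ |\sigma(\xi)|\ge s}\max\{\|u_\xi\|_{L^\infty}^2,\|v_\xi\|_{L^\infty}^2\}\Bigr)^{\frac1p-\frac1q}\in[0,\infty],$$ where those $s$ for which no $\xi$ satisfies $|\sigma(\xi)|\ge s$ contribute $0$ (this matters only for $p=q=2$, where $W(\sigma)=\sup_\xi|\sigma(\xi)|$). Then there is a constant $C<\infty$ such that the following holds for every linear operator $A:C_L^\infty(\overline M)\to C_L^\infty(\overline M)$ and every function $\sigma:\mathcal I\to\mathbb C$ with $\mathcal F_L(Af)(\xi)=\sigma(\xi)\,\mathcal F_Lf(\xi)$ for all $f\in C_L^\infty(\overline M)$ and $\xi\in\mathcal I$ (that is, for every $L$-Fourier multiplier $A$ with $L$-symbol $\sigma$):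 if $W(\sigma)<\infty$, then $A$, restricted to $C_L^\infty(\overline M)\cap L^p(\overline M)$, extends to a bounded linear operator from $L^p(\overline M)$ to $L^q(\overline M)$, and $$\|A\|_{\mathscr B(L^p(\overline M),L^q(\overline M))}\le C\,W(\sigma).$$ -/

import Mathlib

open MeasureTheory
open scoped ENNReal NNReal Manifold ContDiff ComplexConjugate

noncomputable section

/-- A Riesz basis of a Hilbert space: the image of an orthonormal (Hilbert) basis under a bounded
linear bijection with bounded inverse. -/
def IsRieszBasis {ι H : Type*} [NormedAddCommGroup H] [InnerProductSpace ℂ H]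
    (u : ι → H) : Prop :=
  ∃ (e : HilbertBasis ι ℂ H) (T : H ≃L[ℂ] H), ∀ ξ, u ξ = T (e ξ)

/-- The domain of the `k`-th power of an unbounded operator:
`Dom (L ^ 0)` is everything and `Dom (L ^ (k + 1)) = {f ∈ Dom L | L f ∈ Dom (L ^ k)}`. -/
def domPow {H : Type*} [AddCommGroup H] [Module ℂ H] (L : H →ₗ.[ℂ] H) : ℕ → Submodule ℂ H
  | 0 => ⊤
  | k + 1 => ((domPow L k).comap L.toFun).map L.domain.subtype

/-- The space `C_L^∞ = ⋂ₖ Dom (L ^ k)`. -/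
def smoothVectors {H : Type*} [AddCommGroup H] [Module ℂ H] (L : H →ₗ.[ℂ] H) : Submodule ℂ H :=
  ⨅ k : ℕ, domPow L k

/-- The family `u` is a Riesz basis of `L²(μ)` consisting of eigenfunctions of the (possibly
unbounded) operator `L`, with eigenvalues `lam`; the family `v` is biorthogonal to `u` and consists
of eigenfunctions of the Hilbert space adjoint of `L`, with the conjugate eigenvalues. The domain of
`L` is dense because it contains the Riesz basis `u`, so that the adjoint is meaningful. -/
structure IsEigenSystem {M ι : Type*} [MeasurableSpace M] (μ : Measure M)
    (L : Lp ℂ 2 μ →ₗ.[ℂ] Lp ℂ 2 μ) (lam : ι → ℂ) (u v : ι → Lp ℂ 2 μ) : Prop where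
  eigen : ∀ ξ, ∃ h : u ξ ∈ L.domain, L ⟨u ξ, h⟩ = lam ξ • u ξ
  eigen_adjoint : ∀ ξ, ∃ h : v ξ ∈ L.adjoint.domain,
    L.adjoint ⟨v ξ, h⟩ = conj (lam ξ) • v ξ
  biorthogonal_self : ∀ ξ, ∫ x, u ξ x * conj (v ξ x) ∂μ = 1
  biorthogonal_ne : ∀ ξ η, ξ ≠ η → ∫ x, u ξ x * conj (v η x) ∂μ = 0
  riesz : IsRieszBasis u

/-- The `L`-Fourier transform `(ℱ_L f)(ξ) = ∫ f(x) conj (v_ξ(x)) dx`. -/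
def lFourier {M ι : Type*} [MeasurableSpace M] (μ : Measure M) (v : ι → Lp ℂ 2 μ)
    (f : M → ℂ) (ξ : ι) : ℂ :=
  ∫ x, f x * conj (v ξ x) ∂μ

/-- The linear operator `A : C_L^∞ → C_L^∞` is an `L`-Fourier multiplier with `L`-symbol `σ`:
`ℱ_L (A f)(ξ) = σ(ξ) (ℱ_L f)(ξ)` for all `f ∈ C_L^∞` and all `ξ`. -/
def IsLFourierMultiplier {M ι : Type*} [MeasurableSpace M] {μ : Measure M}
    (L : Lp ℂ 2 μ →ₗ.[ℂ] Lp ℂ 2 μ) (v : ι → Lp ℂ 2 μ)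
    (A : smoothVectors L →ₗ[ℂ] smoothVectors L) (σ : ι → ℂ) : Prop :=
  ∀ (f : smoothVectors L) (ξ : ι),
    lFourier μ v ((A f : Lp ℂ 2 μ) : M → ℂ) ξ
      = σ ξ * lFourier μ v ((f : Lp ℂ 2 μ) : M → ℂ) ξ

/-- The quantity `sup_{s > 0} s (∑_{|σ(ξ)| ≥ s} max {‖u_ξ‖_∞², ‖v_ξ‖_∞²}) ^ r` in `[0, ∞]`.
Only those `s` count for which `{ξ : |σ(ξ)| ≥ s}` is nonempty. For `r > 0` this changes nothing;
for `r = 0` it means that an empty sum contributes `0`, so that the quantity is `sup_ξ |σ(ξ)|`. -/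
def symbolWeakNorm {M ι : Type*} [MeasurableSpace M] {μ : Measure M} (u v : ι → Lp ℂ 2 μ)
    (σ : ι → ℂ) (r : ℝ) : ℝ≥0∞ :=
  ⨆ (s : ℝ) (_ : 0 < s) (_ : ∃ ξ, s ≤ ‖σ ξ‖),
    ENNReal.ofReal s *
      (∑' ξ : {ξ : ι // s ≤ ‖σ ξ‖},
        max (eLpNorm (u ξ) ⊤ μ ^ 2) (eLpNorm (v ξ) ⊤ μ ^ 2)) ^ r

end

/-!
Write `w ξ` for the larger of the sup-norms of `u ξ` and `v ξ`, and `f̂ ξ = ∫ f conj (v ξ)`.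

The proof rests on a weighted Bessel inequality. If `h ≥ 0` satisfies the weak-type condition
`∑_{h ≥ s} w ^ 2 ≤ 1 / s`, then for `1 < p ≤ 2`

  `∑ |f̂| ^ 2 h ^ (2 / p - 1) ≤ C ‖f‖_p ^ 2`     (`IsBoundedBessel.exists_tsum_rpow_le`).

For `p = 2` this is the Bessel inequality of a Riesz basis. For `p < 2` normalize `‖f‖_p = 1` and,
on the piece `2 ^ k ≤ h < 2 ^ (k + 1)` of the index set, split `f` where `|f| ^ p = 2 ^ (-k)`. The
coefficients of the large part are at most `w` times its `L¹` norm, and the piece has mass at most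
`2 ^ (-k)` for the measure `w ^ 2`; the small part is in `L²` and the Bessel inequality applies.
Exchanging the sum over `k` with the integral leaves geometric series, dominated by their largest
terms, and both contributions are bounded by `∫ |f| ^ p`.

With `r = 1 / p - 1 / q`, the symbol is a bounded multiple, with bound `W(σ)`, of `h ^ r`, where
`h = (|σ| / W(σ)) ^ (1 / r)` satisfies the weak-type condition (`exists_symbol_factorization`).
Split `r = (1 / p - 1 / 2) + (1 / q' - 1 / 2)`, where `q'` is the exponent conjugate to `q`. By the
weighted Bessel inequality, multiplication of `f̂` by the first power of `h` maps `L^p` to `ℓ²`. By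
duality, the same inequality for the family `u` with the exponent `q'` shows that multiplication by
the second power followed by summation against `u` maps `ℓ²` to `L^q`
(`IsBoundedBessel.exists_eLpNorm_sum_le`). The composition is the operator sought
(`exists_multiplier`). It extends the given multiplier because `A f = ∑ σ f̂ u` in `L²`, and the sums
of one series in `L²` and in `L^q` agree almost everywhere.
-/

/-! ### Geometric series over the integers -/

/-- A geometric series over the integers is dominated by its largest term. -/
theorem exists_tsum_two_rpow_le {β : ℝ} (hβ : 0 < β) :
    ∃ C : ℝ≥0, ∀ y : ℝ≥0∞,
      ∑' k : ℤ, (if (2 : ℝ≥0∞) ^ (k : ℝ) ≤ y then (2 : ℝ≥0∞) ^ ((k : ℝ) * β) else 0)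
        ≤ C * y ^ β := by
  have hr : (2 : ℝ≥0∞) ^ (-β) < 1 := by
    exact ENNReal.rpow_lt_one_of_one_lt_of_neg (by simp) (by simpa using hβ)
  have hfin : (1 - (2 : ℝ≥0∞) ^ (-β))⁻¹ ≠ ⊤ := by
    simpa [tsub_eq_zero_iff_le] using hr
  refine ⟨(1 - (2 : ℝ≥0∞) ^ (-β))⁻¹.toNNReal, fun y ↦ ?_⟩
  rw [ENNReal.coe_toNNReal hfin]
  rcases eq_or_ne y 0 with rfl | hy0
  · have h (k : ℤ) : ¬ (2 : ℝ≥0∞) ^ (k : ℝ) ≤ 0 := by simp [-ENNReal.rpow_intCast]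
    simp only [h, if_false, tsum_zero, zero_le]
  rcases eq_or_ne y ⊤ with rfl | hyt
  · rw [ENNReal.top_rpow_of_pos hβ, ENNReal.mul_top]
    · exact le_top
    · simp
  obtain ⟨n, hn1, hn2⟩ := ENNReal.exists_mem_Ico_zpow hy0 hyt (y := 2) (by simp) (by simp)
  rw [← ENNReal.rpow_intCast] at hn1 hn2
  set F : ℤ → ℝ≥0∞ := fun k ↦
    if (2 : ℝ≥0∞) ^ (k : ℝ) ≤ y then (2 : ℝ≥0∞) ^ ((k : ℝ) * β) else 0
  have hinj : Function.Injective (fun j : ℕ ↦ n - (j : ℤ)) := by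
    intro a b h; simpa using h
  have hsupp : Function.support F ⊆ Set.range (fun j : ℕ ↦ n - (j : ℤ)) := by
    intro k hk
    have hk' : (2 : ℝ≥0∞) ^ (k : ℝ) ≤ y := by
      by_contra h
      simp only [F, h, if_false, Function.mem_support, ne_eq, not_true] at hk
    have h1 : (2 : ℝ≥0∞) ^ (k : ℝ) < (2 : ℝ≥0∞) ^ (((n + 1 : ℤ)) : ℝ) := hk'.trans_lt hn2
    have h2 : k < n + 1 := by
      by_contra hcon
      refine absurd h1 (not_lt.2 (ENNReal.rpow_le_rpow_of_exponent_le (by simp) ?_))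
      exact_mod_cast not_lt.1 hcon
    exact ⟨(n - k).toNat, by simp only; omega⟩
  calc ∑' k, F k = ∑' j : ℕ, F (n - (j : ℤ)) := (hinj.tsum_eq hsupp).symm
    _ ≤ ∑' j : ℕ, (2 : ℝ≥0∞) ^ ((n : ℝ) * β) * ((2 : ℝ≥0∞) ^ (-β)) ^ j := by
        refine ENNReal.tsum_le_tsum fun j ↦ ?_
        simp only [F]
        split_ifs
        · rw [← ENNReal.rpow_natCast, ← ENNReal.rpow_mul, ← ENNReal.rpow_add _ _ (by simp) (by simp)]
          refine le_of_eq ?_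
          congr 1
          push_cast
          ring
        · exact zero_le
    _ = (2 : ℝ≥0∞) ^ ((n : ℝ) * β) * (1 - (2 : ℝ≥0∞) ^ (-β))⁻¹ := by
        rw [ENNReal.tsum_mul_left, ENNReal.tsum_geometric]
    _ ≤ (1 - (2 : ℝ≥0∞) ^ (-β))⁻¹ * y ^ β := by
        rw [mul_comm, ENNReal.rpow_mul]
        gcongr

theorem exists_tsum_two_rpow_neg_le {β : ℝ} (hβ : 0 < β) :
    ∃ C : ℝ≥0, ∀ y : ℝ≥0∞,
      ∑' k : ℤ, (if (2 : ℝ≥0∞) ^ (-(k : ℝ)) < y then (2 : ℝ≥0∞) ^ (-(k : ℝ) * β) else 0)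
        ≤ C * y ^ β := by
  obtain ⟨C, hC⟩ := exists_tsum_two_rpow_le hβ
  refine ⟨C, fun y ↦ le_trans ?_ (hC y)⟩
  rw [← (Equiv.neg ℤ).tsum_eq]
  refine ENNReal.tsum_le_tsum fun k ↦ ?_
  simp only [Equiv.neg_apply, Int.cast_neg, neg_neg]
  split_ifs with h1 h2 h2
  · exact le_rfl
  · exact absurd h1.le h2
  · exact zero_le
  · exact le_rfl

/-! ### Elementary inequalities -/

theorem ENNReal.add_sq_le (a b : ℝ≥0∞) : (a + b) ^ 2 ≤ 2 * (a ^ 2 + b ^ 2) := by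
  have := ENNReal.rpow_add_le_mul_rpow_add_rpow a b (p := 2) (by norm_num)
  norm_num at this
  exact this

theorem enorm_coe_nnreal_complex (a : ℝ≥0) : ‖((a : ℝ) : ℂ)‖ₑ = a := by
  rw [← ofReal_norm, Complex.norm_real, Real.norm_of_nonneg a.coe_nonneg, ENNReal.ofReal_coe_nnreal]

theorem enorm_integral_mul_conj_le {M : Type*} [MeasurableSpace M] {μ : Measure M}
    {f : M → ℂ} (hf : AEStronglyMeasurable f μ) (g : M → ℂ) :
    ‖∫ x, f x * conj (g x) ∂μ‖ₑ ≤ eLpNorm g ⊤ μ * ∫⁻ x, ‖f x‖ₑ ∂μ := by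
  calc ‖∫ x, f x * conj (g x) ∂μ‖ₑ ≤ ∫⁻ x, ‖f x * conj (g x)‖ₑ ∂μ :=
        enorm_integral_le_lintegral_enorm _
    _ ≤ ∫⁻ x, eLpNorm g ⊤ μ * ‖f x‖ₑ ∂μ := by
        refine lintegral_mono_ae ?_
        filter_upwards [enorm_ae_le_eLpNormEssSup g μ] with x hx
        rw [enorm_mul, RCLike.enorm_conj, mul_comm, eLpNorm_exponent_top]
        gcongr
    _ = _ := lintegral_const_mul'' _ hf.enorm

/-! ### Truncation of a function at dyadic levels -/

section Decomposition
variable {M : Type*} (f : M → ℂ) (p : ℝ)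

/-- The set where `|f| ^ p` exceeds `2 ^ (-k)`. -/
def dyadicSuperlevel (k : ℤ) : Set M := {x | (2 : ℝ≥0∞) ^ (-(k : ℝ)) < ‖f x‖ₑ ^ p}

variable {f p}

/-- On the superlevel set `|f|` is at most a multiple of `|f| ^ p`. -/
theorem enorm_le_of_mem_dyadicSuperlevel (hp : 1 < p) {k : ℤ} {x : M}
    (hx : x ∈ dyadicSuperlevel f p k) :
    ‖f x‖ₑ ≤ (2 : ℝ≥0∞) ^ ((k : ℝ) * (1 - 1 / p)) * ‖f x‖ₑ ^ p := by
  have hx' : (2 : ℝ≥0∞) ^ (-(k : ℝ)) < ‖f x‖ₑ ^ p := hx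
  have h0 : ‖f x‖ₑ ≠ 0 := by
    intro h
    rw [h, ENNReal.zero_rpow_of_pos (by linarith)] at hx'
    simp at hx'
  have h1 : (2 : ℝ≥0∞) ^ (-(k : ℝ) * (1 - 1 / p)) ≤ ‖f x‖ₑ ^ (p - 1) := by
    have : p - 1 = p * (1 - 1 / p) := by field_simp
    rw [this, ENNReal.rpow_mul, ENNReal.rpow_mul]
    refine ENNReal.rpow_le_rpow hx'.le ?_
    rw [sub_nonneg, div_le_one (by linarith)]
    exact hp.le
  calc ‖f x‖ₑ = (2 : ℝ≥0∞) ^ ((k : ℝ) * (1 - 1 / p)) *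
          (2 : ℝ≥0∞) ^ (-(k : ℝ) * (1 - 1 / p)) * ‖f x‖ₑ := by
        rw [← ENNReal.rpow_add _ _ (by simp) (by simp)]
        simp
    _ ≤ (2 : ℝ≥0∞) ^ ((k : ℝ) * (1 - 1 / p)) * ‖f x‖ₑ ^ (p - 1) * ‖f x‖ₑ := by gcongr
    _ = _ := by
        rw [mul_assoc]
        congr 1
        nth_rewrite 2 [← ENNReal.rpow_one ‖f x‖ₑ]
        rw [← ENNReal.rpow_add _ _ h0 enorm_ne_top]
        simp

/-- Off the superlevel set `|f| ^ 2` is at most a multiple of `|f| ^ p`. -/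
theorem enorm_sq_le_of_notMem_dyadicSuperlevel (hp : 1 < p) (hp2 : p < 2) {k : ℤ} {x : M}
    (hx : x ∉ dyadicSuperlevel f p k) :
    ‖f x‖ₑ ^ 2 ≤ (2 : ℝ≥0∞) ^ (-(k : ℝ) * (2 / p - 1)) * ‖f x‖ₑ ^ p := by
  have hx' : ‖f x‖ₑ ^ p ≤ (2 : ℝ≥0∞) ^ (-(k : ℝ)) := not_lt.1 hx
  have h1 : 0 ≤ 2 / p - 1 := by
    rw [sub_nonneg, le_div_iff₀ (by linarith)]; linarith
  calc ‖f x‖ₑ ^ 2 = (‖f x‖ₑ ^ p) ^ (2 / p - 1) * ‖f x‖ₑ ^ p := by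
        rw [← ENNReal.rpow_mul, ← ENNReal.rpow_add_of_nonneg _ _ (by positivity) (by linarith),
          ← ENNReal.rpow_natCast]
        congr 1
        field_simp
        push_cast
        ring
    _ ≤ _ := by
        rw [ENNReal.rpow_mul]
        gcongr

variable [MeasurableSpace M] {μ : Measure M}

theorem measurableSet_dyadicSuperlevel (hf : StronglyMeasurable f) (k : ℤ) :
    MeasurableSet (dyadicSuperlevel f p k) :=
  measurableSet_lt measurable_const (hf.measurable.enorm.pow_const p)

theorem lintegral_dyadicSuperlevel_le (hf : StronglyMeasurable f) (hp : 1 < p)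
    (hf1 : ∫⁻ x, ‖f x‖ₑ ^ p ∂μ ≤ 1) (k : ℤ) :
    ∫⁻ x, ‖(dyadicSuperlevel f p k).indicator f x‖ₑ ∂μ
      ≤ (2 : ℝ≥0∞) ^ ((k : ℝ) * (1 - 1 / p)) := by
  calc ∫⁻ x, ‖(dyadicSuperlevel f p k).indicator f x‖ₑ ∂μ
      ≤ ∫⁻ x, (2 : ℝ≥0∞) ^ ((k : ℝ) * (1 - 1 / p)) * ‖f x‖ₑ ^ p ∂μ := by
        refine lintegral_mono fun x ↦ ?_
        by_cases hx : x ∈ dyadicSuperlevel f p k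
        · simpa [hx] using enorm_le_of_mem_dyadicSuperlevel hp hx
        · simp [hx]
    _ ≤ _ := by
        rw [lintegral_const_mul _ (hf.measurable.enorm.pow_const p)]
        exact mul_le_of_le_one_right' hf1

theorem integrable_dyadicSuperlevel (hf : StronglyMeasurable f) (hp : 1 < p)
    (hf1 : ∫⁻ x, ‖f x‖ₑ ^ p ∂μ ≤ 1) (k : ℤ) :
    Integrable ((dyadicSuperlevel f p k).indicator f) μ := by
  refine ⟨(hf.indicator (measurableSet_dyadicSuperlevel hf k)).aestronglyMeasurable, ?_⟩
  refine (lintegral_dyadicSuperlevel_le hf hp hf1 k).trans_lt ?_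
  exact (ENNReal.rpow_ne_top_of_ne_zero (by simp) (by simp)).lt_top

theorem memLp_two_dyadicSuperlevel_compl (hf : StronglyMeasurable f) (hp : 1 < p) (hp2 : p < 2)
    (hf1 : ∫⁻ x, ‖f x‖ₑ ^ p ∂μ ≤ 1) (k : ℤ) :
    MemLp ((dyadicSuperlevel f p k)ᶜ.indicator f) 2 μ := by
  refine ⟨(hf.indicator (measurableSet_dyadicSuperlevel hf k).compl).aestronglyMeasurable, ?_⟩
  rw [eLpNorm_lt_top_iff_lintegral_rpow_enorm_lt_top (by simp) (by simp)]
  calc ∫⁻ x, ‖(dyadicSuperlevel f p k)ᶜ.indicator f x‖ₑ ^ (2 : ℝ≥0∞).toReal ∂μ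
      ≤ ∫⁻ x, (2 : ℝ≥0∞) ^ (-(k : ℝ) * (2 / p - 1)) * ‖f x‖ₑ ^ p ∂μ := by
        refine lintegral_mono fun x ↦ ?_
        by_cases hx : x ∈ dyadicSuperlevel f p k
        · simp [hx]
        · simpa [hx] using enorm_sq_le_of_notMem_dyadicSuperlevel hp hp2 hx
    _ ≤ (2 : ℝ≥0∞) ^ (-(k : ℝ) * (2 / p - 1)) := by
        rw [lintegral_const_mul _ (hf.measurable.enorm.pow_const p)]
        exact mul_le_of_le_one_right' hf1
    _ < ⊤ := (ENNReal.rpow_ne_top_of_ne_zero (by simp) (by simp)).lt_top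

/-- Summed over the dyadic levels, the squared `L¹` norms of the large parts of `f` are controlled
by `∫ |f| ^ p`. Each `L¹` norm is bounded by a power of the level, so only one factor of the square
has to be summed. -/
theorem exists_tsum_lintegral_dyadicSuperlevel_le (hp : 1 < p) :
    ∃ C : ℝ≥0, ∀ f : M → ℂ, StronglyMeasurable f → ∫⁻ x, ‖f x‖ₑ ^ p ∂μ ≤ 1 →
      ∑' k : ℤ, (2 : ℝ≥0∞) ^ ((k : ℝ) * (2 / p - 2)) *
        (∫⁻ x, ‖(dyadicSuperlevel f p k).indicator f x‖ₑ ∂μ) ^ 2 ≤ C := by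
  have hp' : 0 < 1 - 1 / p := by
    rw [sub_pos, div_lt_one (by linarith)]
    exact hp
  obtain ⟨C, hC⟩ := exists_tsum_two_rpow_neg_le hp'
  refine ⟨C, fun f hf hf1 ↦ ?_⟩
  calc ∑' k : ℤ, (2 : ℝ≥0∞) ^ ((k : ℝ) * (2 / p - 2)) *
        (∫⁻ x, ‖(dyadicSuperlevel f p k).indicator f x‖ₑ ∂μ) ^ 2
      ≤ ∑' k : ℤ, ∫⁻ x, (2 : ℝ≥0∞) ^ (-(k : ℝ) * (1 - 1 / p)) *
          ‖(dyadicSuperlevel f p k).indicator f x‖ₑ ∂μ := by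
        refine ENNReal.tsum_le_tsum fun k ↦ ?_
        rw [lintegral_const_mul _
          (hf.indicator (measurableSet_dyadicSuperlevel hf k)).measurable.enorm, sq, ← mul_assoc]
        gcongr
        calc _ ≤ (2 : ℝ≥0∞) ^ ((k : ℝ) * (2 / p - 2)) * (2 : ℝ≥0∞) ^ ((k : ℝ) * (1 - 1 / p)) := by
              gcongr
              exact lintegral_dyadicSuperlevel_le hf hp hf1 k
          _ = _ := by
              rw [← ENNReal.rpow_add _ _ (by simp) (by simp)]
              congr 1
              ring
    _ = ∫⁻ x, ∑' k : ℤ, (2 : ℝ≥0∞) ^ (-(k : ℝ) * (1 - 1 / p)) *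
          ‖(dyadicSuperlevel f p k).indicator f x‖ₑ ∂μ := by
        refine (lintegral_tsum fun k ↦ ?_).symm
        exact ((hf.indicator
          (measurableSet_dyadicSuperlevel hf k)).measurable.enorm.const_mul _).aemeasurable
    _ ≤ ∫⁻ x, C * ‖f x‖ₑ ^ p ∂μ := by
        refine lintegral_mono fun x ↦ ?_
        calc ∑' k : ℤ, (2 : ℝ≥0∞) ^ (-(k : ℝ) * (1 - 1 / p)) *
              ‖(dyadicSuperlevel f p k).indicator f x‖ₑ
            = (∑' k : ℤ, (if (2 : ℝ≥0∞) ^ (-(k : ℝ)) < ‖f x‖ₑ ^ p then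
                (2 : ℝ≥0∞) ^ (-(k : ℝ) * (1 - 1 / p)) else 0)) * ‖f x‖ₑ := by
              rw [← ENNReal.tsum_mul_right]
              refine tsum_congr fun k ↦ ?_
              by_cases hx : x ∈ dyadicSuperlevel f p k
              · have : (2 : ℝ≥0∞) ^ (-(k : ℝ)) < ‖f x‖ₑ ^ p := hx
                simp [hx, this]
              · have : ¬ (2 : ℝ≥0∞) ^ (-(k : ℝ)) < ‖f x‖ₑ ^ p := hx
                simp [hx, this]
          _ ≤ C * (‖f x‖ₑ ^ p) ^ (1 - 1 / p) * ‖f x‖ₑ := by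
              gcongr
              exact hC _
          _ = C * ‖f x‖ₑ ^ p := by
              rw [mul_assoc, ← ENNReal.rpow_mul]
              congr 1
              nth_rewrite 2 [← ENNReal.rpow_one ‖f x‖ₑ]
              rw [← ENNReal.rpow_add_of_nonneg _ _ (by nlinarith) zero_le_one]
              congr 1
              field_simp
              ring
    _ ≤ C := by
        rw [lintegral_const_mul _ (hf.measurable.enorm.pow_const p)]
        exact mul_le_of_le_one_right' hf1

/-- Summed over the dyadic levels, the squared `L²` norms of the small parts of `f` are controlled
by `∫ |f| ^ p`. -/
theorem exists_tsum_lintegral_dyadicSuperlevel_compl_le (hp : 1 < p) (hp2 : p < 2) :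
    ∃ C : ℝ≥0, ∀ f : M → ℂ, StronglyMeasurable f → ∫⁻ x, ‖f x‖ₑ ^ p ∂μ ≤ 1 →
      ∑' k : ℤ, (2 : ℝ≥0∞) ^ ((k : ℝ) * (2 / p - 1)) *
        ∫⁻ x, ‖(dyadicSuperlevel f p k)ᶜ.indicator f x‖ₑ ^ 2 ∂μ ≤ C := by
  have hp' : 0 < 2 / p - 1 := by
    rw [sub_pos, lt_div_iff₀ (by linarith)]
    linarith
  obtain ⟨C, hC⟩ := exists_tsum_two_rpow_le hp'
  refine ⟨C, fun f hf hf1 ↦ ?_⟩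
  calc ∑' k : ℤ, (2 : ℝ≥0∞) ^ ((k : ℝ) * (2 / p - 1)) *
        ∫⁻ x, ‖(dyadicSuperlevel f p k)ᶜ.indicator f x‖ₑ ^ 2 ∂μ
      = ∫⁻ x, ∑' k : ℤ, (2 : ℝ≥0∞) ^ ((k : ℝ) * (2 / p - 1)) *
          ‖(dyadicSuperlevel f p k)ᶜ.indicator f x‖ₑ ^ 2 ∂μ := by
        have hm (k : ℤ) : Measurable fun x ↦ ‖(dyadicSuperlevel f p k)ᶜ.indicator f x‖ₑ ^ 2 :=
          (hf.indicator (measurableSet_dyadicSuperlevel hf k).compl).measurable.enorm.pow_const 2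
        rw [lintegral_tsum fun k ↦ ((hm k).const_mul _).aemeasurable]
        exact tsum_congr fun k ↦ (lintegral_const_mul _ (hm k)).symm
    _ ≤ ∫⁻ x, C * ‖f x‖ₑ ^ p ∂μ := by
        refine lintegral_mono fun x ↦ ?_
        rcases eq_or_ne (f x) 0 with h0 | h0
        · have h (k : ℤ) : (dyadicSuperlevel f p k)ᶜ.indicator f x = 0 := by
            simp [h0]
          simp [h]
        have h0' : ‖f x‖ₑ ≠ 0 := by simpa using h0
        calc ∑' k : ℤ, (2 : ℝ≥0∞) ^ ((k : ℝ) * (2 / p - 1)) *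
              ‖(dyadicSuperlevel f p k)ᶜ.indicator f x‖ₑ ^ 2
            = (∑' k : ℤ, (if (2 : ℝ≥0∞) ^ (k : ℝ) ≤ ‖f x‖ₑ ^ (-p) then
                (2 : ℝ≥0∞) ^ ((k : ℝ) * (2 / p - 1)) else 0)) * ‖f x‖ₑ ^ 2 := by
              rw [← ENNReal.tsum_mul_right]
              refine tsum_congr fun k ↦ ?_
              have hiff : (2 : ℝ≥0∞) ^ (k : ℝ) ≤ ‖f x‖ₑ ^ (-p) ↔ x ∉ dyadicSuperlevel f p k := by
                rw [ENNReal.rpow_neg, ← ENNReal.inv_le_inv, inv_inv, ← ENNReal.rpow_neg]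
                exact not_lt.symm
              by_cases hx : x ∈ dyadicSuperlevel f p k
              · rw [if_neg fun h ↦ hiff.1 h hx]; simp [hx]
              · rw [if_pos (hiff.2 hx)]; simp [hx]
          _ ≤ C * (‖f x‖ₑ ^ (-p)) ^ (2 / p - 1) * ‖f x‖ₑ ^ 2 := by
              gcongr
              exact hC _
          _ = C * ‖f x‖ₑ ^ p := by
              rw [mul_assoc, ← ENNReal.rpow_mul, ← ENNReal.rpow_natCast,
                ← ENNReal.rpow_add _ _ h0' enorm_ne_top]
              congr 2
              field_simp
              push_cast
              ring
    _ ≤ C := by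
        rw [lintegral_const_mul _ (hf.measurable.enorm.pow_const p)]
        exact mul_le_of_le_one_right' hf1

end Decomposition

/-! ### Bessel systems and weak-type weights -/

/-- A Bessel system in `L²(μ)` with Bessel constant `K`, consisting of bounded functions whose
sup-norms are dominated by the weights `w`. -/
structure IsBoundedBessel {M ι : Type*} [MeasurableSpace M] {μ : Measure M}
    (v : ι → Lp ℂ 2 μ) (w : ι → ℝ≥0∞) (K : ℝ≥0) : Prop where
  memLp_top : ∀ ξ, MemLp (v ξ) ⊤ μ
  eLpNorm_top_le : ∀ ξ, eLpNorm (v ξ) ⊤ μ ≤ w ξ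
  bessel : ∀ f : Lp ℂ 2 μ, ∑' ξ, ‖inner ℂ (v ξ) f‖ₑ ^ 2 ≤ K * ‖f‖ₑ ^ 2

/-- The function `h` lies in the unit ball of weak `ℓ¹` with respect to the measure `w ^ 2` on the
index set: `∑_{h ≥ s} w ^ 2 ≤ 1 / s`. Only dyadic `s` are required. -/
def IsWeakSummable {ι : Type*} (w : ι → ℝ≥0∞) (h : ι → ℝ≥0) : Prop :=
  ∀ k : ℤ, ∑' ξ, (if (2 : ℝ≥0∞) ^ (k : ℝ) ≤ h ξ then w ξ ^ 2 else 0) ≤ (2 : ℝ≥0∞) ^ (-(k : ℝ))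

/-- The dyadic piece `2 ^ k ≤ h < 2 ^ (k + 1)` of the index set. -/
def dyadicPiece {ι : Type*} (h : ι → ℝ≥0) (k : ℤ) : Set ι :=
  {ξ | (2 : ℝ≥0∞) ^ (k : ℝ) ≤ h ξ ∧ (h ξ : ℝ≥0∞) < (2 : ℝ≥0∞) ^ ((k : ℝ) + 1)}

theorem rpow_le_tsum_dyadicPiece {ι : Type*} (h : ι → ℝ≥0) {α : ℝ} (hα : 0 < α) (ξ : ι) :
    (h ξ : ℝ≥0∞) ^ α ≤
      ∑' k : ℤ, (dyadicPiece h k).indicator (fun _ ↦ (2 : ℝ≥0∞) ^ (((k : ℝ) + 1) * α)) ξ := by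
  rcases eq_or_ne (h ξ) 0 with h0 | h0
  · simp [h0, hα]
  obtain ⟨n, hn1, hn2⟩ := ENNReal.exists_mem_Ico_zpow (x := h ξ) (by simpa using h0)
    ENNReal.coe_ne_top (y := 2) (by simp) (by simp)
  rw [← ENNReal.rpow_intCast] at hn1 hn2
  push_cast at hn2
  refine le_trans ?_ (ENNReal.le_tsum n)
  rw [Set.indicator_of_mem (show ξ ∈ dyadicPiece h n from ⟨hn1, hn2⟩), ENNReal.rpow_mul]
  gcongr

/-! ### The weighted Bessel inequality -/

section Bessel
variable {M ι : Type*} [MeasurableSpace M] {μ : Measure M}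

theorem lFourier_eq_inner (v : ι → Lp ℂ 2 μ) (f : Lp ℂ 2 μ) (ξ : ι) :
    lFourier μ v f ξ = inner ℂ (v ξ) f := by
  rw [L2.inner_def]
  simp [lFourier, RCLike.inner_apply]

theorem lFourier_congr_ae (v : ι → Lp ℂ 2 μ) {f g : M → ℂ} (h : f =ᵐ[μ] g) (ξ : ι) :
    lFourier μ v f ξ = lFourier μ v g ξ := by
  refine integral_congr_ae ?_
  filter_upwards [h] with x hx
  rw [hx]

theorem lFourier_const_mul (v : ι → Lp ℂ 2 μ) (c : ℂ) (f : M → ℂ) (ξ : ι) :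
    lFourier μ v (fun x ↦ c * f x) ξ = c * lFourier μ v f ξ := by
  simp [lFourier, mul_assoc, integral_const_mul]

theorem MeasureTheory.MemLp.integrable_mul_conj {p q : ℝ≥0∞} [p.HolderConjugate q] {f g : M → ℂ}
    (hf : MemLp f p μ) (hg : MemLp g q μ) : Integrable (fun x ↦ f x * conj (g x)) μ :=
  hf.integrable_mul hg.star

theorem IsBoundedBessel.tsum_lFourier_le {v : ι → Lp ℂ 2 μ} {w : ι → ℝ≥0∞} {K : ℝ≥0}
    (hv : IsBoundedBessel v w K) {f : M → ℂ} (hf : MemLp f 2 μ) :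
    ∑' ξ, ‖lFourier μ v f ξ‖ₑ ^ 2 ≤ K * eLpNorm f 2 μ ^ 2 := by
  have h := hv.bessel (hf.toLp f)
  rw [Lp.enorm_toLp] at h
  refine le_trans (le_of_eq (tsum_congr fun ξ ↦ ?_)) h
  rw [← lFourier_eq_inner, lFourier_congr_ae v hf.coeFn_toLp]

theorem eLpNorm_two_sq (f : M → ℂ) : eLpNorm f 2 μ ^ 2 = ∫⁻ x, ‖f x‖ₑ ^ 2 ∂μ := by
  rw [eLpNorm_eq_lintegral_rpow_enorm_toReal (by simp) (by simp), ← ENNReal.rpow_natCast,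
    ← ENNReal.rpow_mul]
  simp

variable {p : ℝ}

theorem IsBoundedBessel.integrable_of_lintegral_le_one {v : ι → Lp ℂ 2 μ} {w : ι → ℝ≥0∞} {K : ℝ≥0}
    (hv : IsBoundedBessel v w K) (hp : 1 < p) (hp2 : p < 2) {f : M → ℂ}
    (hf : StronglyMeasurable f) (hf1 : ∫⁻ x, ‖f x‖ₑ ^ p ∂μ ≤ 1) (k : ℤ) (ξ : ι) :
    Integrable (fun x ↦ (dyadicSuperlevel f p k).indicator f x * conj (v ξ x)) μ ∧
      Integrable (fun x ↦ (dyadicSuperlevel f p k)ᶜ.indicator f x * conj (v ξ x)) μ :=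
  ⟨MemLp.integrable_mul_conj (p := 1) (q := ⊤)
      (memLp_one_iff_integrable.2 (integrable_dyadicSuperlevel hf hp hf1 k)) (hv.memLp_top ξ),
    MemLp.integrable_mul_conj (p := 2) (q := 2) (memLp_two_dyadicSuperlevel_compl hf hp hp2 hf1 k)
      (Lp.memLp (v ξ))⟩

/-- On one dyadic piece of the index set, `f` is split at the matching level: the large part is
estimated in `L¹` through the sup-norms, the small part in `L²` through the Bessel inequality. -/
theorem IsBoundedBessel.tsum_dyadicPiece_le {v : ι → Lp ℂ 2 μ} {w : ι → ℝ≥0∞} {K : ℝ≥0}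
    (hv : IsBoundedBessel v w K) (hp : 1 < p) (hp2 : p < 2) {h : ι → ℝ≥0}
    (hh : IsWeakSummable w h) {f : M → ℂ} (hf : StronglyMeasurable f)
    (hf1 : ∫⁻ x, ‖f x‖ₑ ^ p ∂μ ≤ 1) (k : ℤ) :
    ∑' ξ, (dyadicPiece h k).indicator (fun ξ ↦ ‖lFourier μ v f ξ‖ₑ ^ 2) ξ ≤
      2 * ((2 : ℝ≥0∞) ^ (-(k : ℝ)) *
          (∫⁻ x, ‖(dyadicSuperlevel f p k).indicator f x‖ₑ ∂μ) ^ 2 +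
        K * ∫⁻ x, ‖(dyadicSuperlevel f p k)ᶜ.indicator f x‖ₑ ^ 2 ∂μ) := by
  set F := (dyadicSuperlevel f p k).indicator f with hF
  set G := (dyadicSuperlevel f p k)ᶜ.indicator f with hG
  have hsplit (ξ : ι) : lFourier μ v f ξ = lFourier μ v F ξ + lFourier μ v G ξ := by
    have hi := hv.integrable_of_lintegral_le_one hp hp2 hf hf1 k ξ
    rw [lFourier, lFourier, lFourier, ← integral_add hi.1 hi.2]
    refine integral_congr_ae (.of_forall fun x ↦ ?_)
    simp only [← add_mul]
    congr 1
    exact (congrFun (Set.indicator_self_add_compl (dyadicSuperlevel f p k) f) x).symm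
  have hFm : AEStronglyMeasurable F μ :=
    (hf.indicator (measurableSet_dyadicSuperlevel hf k)).aestronglyMeasurable
  calc ∑' ξ, (dyadicPiece h k).indicator (fun ξ ↦ ‖lFourier μ v f ξ‖ₑ ^ 2) ξ
      ≤ ∑' ξ, 2 * ((if (2 : ℝ≥0∞) ^ (k : ℝ) ≤ h ξ then w ξ ^ 2 else 0) *
          (∫⁻ x, ‖F x‖ₑ ∂μ) ^ 2 + ‖lFourier μ v G ξ‖ₑ ^ 2) := by
        refine ENNReal.tsum_le_tsum fun ξ ↦ ?_
        by_cases hξ : ξ ∈ dyadicPiece h k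
        · rw [Set.indicator_of_mem hξ, if_pos hξ.1, hsplit, ← mul_pow]
          calc _ ≤ (‖lFourier μ v F ξ‖ₑ + ‖lFourier μ v G ξ‖ₑ) ^ 2 := by
                gcongr
                exact enorm_add_le _ _
            _ ≤ _ := ENNReal.add_sq_le _ _
            _ ≤ _ := by
                gcongr
                refine (enorm_integral_mul_conj_le hFm _).trans ?_
                gcongr
                exact hv.eLpNorm_top_le ξ
        · rw [Set.indicator_of_notMem hξ]
          exact zero_le
    _ ≤ _ := by
        rw [ENNReal.tsum_mul_left, ENNReal.tsum_add, ENNReal.tsum_mul_right]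
        gcongr
        · exact hh k
        · rw [← eLpNorm_two_sq]
          exact hv.tsum_lFourier_le (memLp_two_dyadicSuperlevel_compl hf hp hp2 hf1 k)

/-- The normalized weighted Bessel inequality for `1 < p < 2`, a Hardy–Littlewood–Paley inequality
with exponent `2` on the coefficient side. -/
theorem IsBoundedBessel.exists_tsum_rpow_le_of_lintegral_le_one {v : ι → Lp ℂ 2 μ} {w : ι → ℝ≥0∞}
    {K : ℝ≥0} (hv : IsBoundedBessel v w K) (hp : 1 < p) (hp2 : p < 2) :
    ∃ C : ℝ≥0, ∀ h : ι → ℝ≥0, IsWeakSummable w h → ∀ f : M → ℂ, StronglyMeasurable f →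
      ∫⁻ x, ‖f x‖ₑ ^ p ∂μ ≤ 1 →
      ∑' ξ, ‖lFourier μ v f ξ‖ₑ ^ 2 * (h ξ : ℝ≥0∞) ^ (2 / p - 1) ≤ C := by
  have hα : 0 < 2 / p - 1 := by
    rw [sub_pos, lt_div_iff₀ (by linarith)]
    linarith
  obtain ⟨C₁, hC₁⟩ := exists_tsum_lintegral_dyadicSuperlevel_le (μ := μ) hp
  obtain ⟨C₂, hC₂⟩ := exists_tsum_lintegral_dyadicSuperlevel_compl_le (μ := μ) hp hp2
  have hD : (2 : ℝ≥0∞) ^ (2 / p - 1) * (2 * (C₁ + K * C₂)) ≠ ⊤ := by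
    refine ENNReal.mul_ne_top (ENNReal.rpow_ne_top_of_ne_zero (by simp) (by simp)) ?_
    exact ENNReal.mul_ne_top (by simp) (by finiteness)
  refine ⟨((2 : ℝ≥0∞) ^ (2 / p - 1) * (2 * (C₁ + K * C₂))).toNNReal, fun h hh f hf hf1 ↦ ?_⟩
  rw [ENNReal.coe_toNNReal hD]
  set I : ℤ → ℝ≥0∞ := fun k ↦ (∫⁻ x, ‖(dyadicSuperlevel f p k).indicator f x‖ₑ ∂μ) ^ 2
  set J : ℤ → ℝ≥0∞ := fun k ↦ ∫⁻ x, ‖(dyadicSuperlevel f p k)ᶜ.indicator f x‖ₑ ^ 2 ∂μ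
  calc ∑' ξ, ‖lFourier μ v f ξ‖ₑ ^ 2 * (h ξ : ℝ≥0∞) ^ (2 / p - 1)
      ≤ ∑' ξ, ∑' k : ℤ, (2 : ℝ≥0∞) ^ (((k : ℝ) + 1) * (2 / p - 1)) *
          (dyadicPiece h k).indicator (fun ξ ↦ ‖lFourier μ v f ξ‖ₑ ^ 2) ξ := by
        refine ENNReal.tsum_le_tsum fun ξ ↦ ?_
        calc _ ≤ ‖lFourier μ v f ξ‖ₑ ^ 2 * ∑' k : ℤ, (dyadicPiece h k).indicator
                (fun _ ↦ (2 : ℝ≥0∞) ^ (((k : ℝ) + 1) * (2 / p - 1))) ξ := by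
              gcongr
              exact rpow_le_tsum_dyadicPiece h hα ξ
          _ = _ := by
              rw [← ENNReal.tsum_mul_left]
              refine tsum_congr fun k ↦ ?_
              by_cases hξ : ξ ∈ dyadicPiece h k
              · simp [hξ, mul_comm]
              · simp [hξ]
    _ = ∑' k : ℤ, (2 : ℝ≥0∞) ^ (((k : ℝ) + 1) * (2 / p - 1)) *
          ∑' ξ, (dyadicPiece h k).indicator (fun ξ ↦ ‖lFourier μ v f ξ‖ₑ ^ 2) ξ := by
        rw [ENNReal.tsum_comm]
        exact tsum_congr fun k ↦ ENNReal.tsum_mul_left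
    _ ≤ ∑' k : ℤ, (2 : ℝ≥0∞) ^ (((k : ℝ) + 1) * (2 / p - 1)) *
          (2 * ((2 : ℝ≥0∞) ^ (-(k : ℝ)) * I k + K * J k)) := by
        gcongr with k
        exact hv.tsum_dyadicPiece_le hp hp2 hh hf hf1 k
    -- The powers of `2` are regrouped to match the two summed level estimates.
    _ = ∑' k : ℤ, (2 : ℝ≥0∞) ^ (2 / p - 1) * (2 * ((2 : ℝ≥0∞) ^ ((k : ℝ) * (2 / p - 2)) * I k +
          K * ((2 : ℝ≥0∞) ^ ((k : ℝ) * (2 / p - 1)) * J k))) := by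
        refine tsum_congr fun k ↦ ?_
        have h1 : (2 : ℝ≥0∞) ^ (((k : ℝ) + 1) * (2 / p - 1)) =
            (2 : ℝ≥0∞) ^ (2 / p - 1) * (2 : ℝ≥0∞) ^ ((k : ℝ) * (2 / p - 1)) := by
          rw [← ENNReal.rpow_add _ _ (by simp) (by simp)]
          congr 1
          ring
        have h2 : (2 : ℝ≥0∞) ^ ((k : ℝ) * (2 / p - 2)) =
            (2 : ℝ≥0∞) ^ ((k : ℝ) * (2 / p - 1)) * (2 : ℝ≥0∞) ^ (-(k : ℝ)) := by
          rw [← ENNReal.rpow_add _ _ (by simp) (by simp)]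
          congr 1
          ring
        rw [h1, h2]
        ring
    _ ≤ _ := by
        rw [ENNReal.tsum_mul_left, ENNReal.tsum_mul_left, ENNReal.tsum_add, ENNReal.tsum_mul_left]
        gcongr
        · exact hC₁ f hf hf1
        · exact hC₂ f hf hf1

theorem lintegral_enorm_rpow_eq (hp : 0 < p) (f : M → ℂ) :
    ∫⁻ x, ‖f x‖ₑ ^ p ∂μ = eLpNorm f (ENNReal.ofReal p) μ ^ p := by
  rw [eLpNorm_eq_lintegral_rpow_enorm_toReal (by simpa using hp) (by simp), ← ENNReal.rpow_mul,
    ENNReal.toReal_ofReal hp.le, one_div, inv_mul_cancel₀ hp.ne', ENNReal.rpow_one]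

/-- A nonzero `L^p` function is a multiple of a strongly measurable one with `∫ |g| ^ p ≤ 1`. -/
theorem exists_normalized (hp : 0 < p) {f : M → ℂ} (hf : MemLp f (ENNReal.ofReal p) μ)
    (h0 : eLpNorm f (ENNReal.ofReal p) μ ≠ 0) :
    ∃ g : M → ℂ, StronglyMeasurable g ∧ ∫⁻ x, ‖g x‖ₑ ^ p ∂μ ≤ 1 ∧
      f =ᵐ[μ] fun x ↦ ((eLpNorm f (ENNReal.ofReal p) μ).toReal : ℂ) * g x := by
  set N := eLpNorm f (ENNReal.ofReal p) μ with hN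
  have hNt : N ≠ ⊤ := hf.eLpNorm_ne_top
  have hNr : (N.toReal : ℂ) ≠ 0 := by
    simpa [ENNReal.toReal_eq_zero_iff] using ⟨h0, hNt⟩
  have hf' : AEStronglyMeasurable f μ := hf.1
  have hNe : ‖(N.toReal : ℂ)‖ₑ = N := by
    rw [← ofReal_norm, Complex.norm_real, Real.norm_of_nonneg ENNReal.toReal_nonneg,
      ENNReal.ofReal_toReal hNt]
  refine ⟨fun x ↦ (N.toReal : ℂ)⁻¹ * hf'.mk f x, hf'.stronglyMeasurable_mk.const_mul _, ?_, ?_⟩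
  · have : eLpNorm (fun x ↦ (N.toReal : ℂ)⁻¹ * hf'.mk f x) (ENNReal.ofReal p) μ = N⁻¹ * N := by
      rw [show (fun x ↦ (N.toReal : ℂ)⁻¹ * hf'.mk f x) = (N.toReal : ℂ)⁻¹ • hf'.mk f from rfl,
        eLpNorm_const_smul, enorm_inv hNr, hNe, ← eLpNorm_congr_ae hf'.ae_eq_mk]
    rw [lintegral_enorm_rpow_eq hp, this, ENNReal.inv_mul_cancel h0 hNt, ENNReal.one_rpow]
  · filter_upwards [hf'.ae_eq_mk] with x hx
    rw [hx, mul_inv_cancel_left₀ hNr]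

/-- The weighted Bessel inequality. For `p = 2` the weight is `1` and no condition on `h` is
needed. -/
theorem IsBoundedBessel.exists_tsum_rpow_le {v : ι → Lp ℂ 2 μ} {w : ι → ℝ≥0∞}
    {K : ℝ≥0} (hv : IsBoundedBessel v w K) (hp : 1 < p) (hp2 : p ≤ 2) :
    ∃ C : ℝ≥0, ∀ h : ι → ℝ≥0, (p < 2 → IsWeakSummable w h) → ∀ f : M → ℂ,
      MemLp f (ENNReal.ofReal p) μ →
      ∑' ξ, ‖lFourier μ v f ξ‖ₑ ^ 2 * (h ξ : ℝ≥0∞) ^ (2 / p - 1) ≤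
        (C * eLpNorm f (ENNReal.ofReal p) μ) ^ 2 := by
  rcases hp2.lt_or_eq with hp2 | rfl
  · obtain ⟨C, hC⟩ := hv.exists_tsum_rpow_le_of_lintegral_le_one hp hp2
    refine ⟨NNReal.sqrt C, fun h hh f hf ↦ ?_⟩
    rcases eq_or_ne (eLpNorm f (ENNReal.ofReal p) μ) 0 with h0 | h0
    · have hf0 : f =ᵐ[μ] 0 := (eLpNorm_eq_zero_iff hf.1 (by simp; linarith)).1 h0
      have (ξ : ι) : lFourier μ v f ξ = 0 := by
        rw [lFourier_congr_ae v hf0]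
        simp [lFourier]
      simp [this]
    obtain ⟨g, hg, hg1, hfg⟩ := exists_normalized (by linarith) hf h0
    set N := eLpNorm f (ENNReal.ofReal p) μ with hN
    have hNe : ‖(N.toReal : ℂ)‖ₑ = N := by
      rw [← ofReal_norm, Complex.norm_real, Real.norm_of_nonneg ENNReal.toReal_nonneg,
        ENNReal.ofReal_toReal hf.eLpNorm_ne_top]
    calc ∑' ξ, ‖lFourier μ v f ξ‖ₑ ^ 2 * (h ξ : ℝ≥0∞) ^ (2 / p - 1)
        = N ^ 2 * ∑' ξ, ‖lFourier μ v g ξ‖ₑ ^ 2 * (h ξ : ℝ≥0∞) ^ (2 / p - 1) := by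
          rw [← ENNReal.tsum_mul_left]
          refine tsum_congr fun ξ ↦ ?_
          rw [lFourier_congr_ae v hfg, lFourier_const_mul, enorm_mul, hNe, mul_pow, mul_assoc]
      _ ≤ N ^ 2 * C := by
          gcongr
          exact hC h (hh hp2) g hg hg1
      _ = _ := by
          rw [mul_pow, ← ENNReal.coe_pow, NNReal.sq_sqrt, mul_comm]
  · refine ⟨NNReal.sqrt K, fun h _ f hf ↦ ?_⟩
    have h2 : ENNReal.ofReal 2 = 2 := by simp
    rw [h2] at hf ⊢
    simpa [mul_pow, ← ENNReal.coe_pow] using hv.tsum_lFourier_le hf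

theorem IsBoundedBessel.integrable_mul_conj {v : ι → Lp ℂ 2 μ} {w : ι → ℝ≥0∞}
    {K : ℝ≥0} (hv : IsBoundedBessel v w K) (hp : 1 < p) (hp2 : p ≤ 2) {f : M → ℂ}
    (hf : MemLp f (ENNReal.ofReal p) μ) (ξ : ι) :
    Integrable (fun x ↦ f x * conj (v ξ x)) μ := by
  rcases hp2.lt_or_eq with hp2 | rfl
  · rcases eq_or_ne (eLpNorm f (ENNReal.ofReal p) μ) 0 with h0 | h0
    · have hf0 : f =ᵐ[μ] 0 := (eLpNorm_eq_zero_iff hf.1 (by simp; linarith)).1 h0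
      refine (integrable_zero M ℂ μ).congr ?_
      filter_upwards [hf0] with x hx
      simp [hx]
    obtain ⟨g, hg, hg1, hfg⟩ := exists_normalized (by linarith) hf h0
    have hi := hv.integrable_of_lintegral_le_one hp hp2 hg hg1 0 ξ
    refine ((hi.1.add hi.2).const_mul
      ((eLpNorm f (ENNReal.ofReal p) μ).toReal : ℂ)).congr ?_
    filter_upwards [hfg] with x hx
    rw [hx, mul_assoc, Pi.add_apply, ← add_mul]
    congr 2
    exact congrFun (Set.indicator_self_add_compl (dyadicSuperlevel g p 0) g) x
  · have h2 : ENNReal.ofReal 2 = 2 := by simp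
    rw [h2] at hf
    exact MemLp.integrable_mul_conj hf (Lp.memLp (v ξ))

end Bessel

/-! ### The synthesis estimate -/

/-- The function extremal for `T` in Hölder's inequality. -/
noncomputable def dualFunction {M : Type*} (q : ℝ) (T : M → ℂ) (x : M) : ℂ :=
  ((‖T x‖ ^ (q - 2) : ℝ) : ℂ) * T x

theorem mul_conj_dualFunction {M : Type*} {q : ℝ} (hq : 2 ≤ q) (T : M → ℂ) (x : M) :
    T x * conj (dualFunction q T x) = ((‖T x‖ ^ q : ℝ) : ℂ) := by
  rw [dualFunction, map_mul, Complex.conj_ofReal, mul_left_comm, Complex.mul_conj,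
    Complex.normSq_eq_norm_sq, ← Complex.ofReal_mul, ← Real.rpow_natCast,
    ← Real.rpow_add_of_nonneg (norm_nonneg _) (by linarith) (by positivity)]
  congr 2
  push_cast
  ring

theorem enorm_dualFunction {M : Type*} {q : ℝ} (hq : 2 ≤ q) (T : M → ℂ) (x : M) :
    ‖dualFunction q T x‖ₑ = ‖T x‖ₑ ^ (q - 1) := by
  have h : ‖dualFunction q T x‖ = ‖T x‖ ^ (q - 1) := by
    rw [dualFunction, norm_mul, Complex.norm_real, Real.norm_of_nonneg (by positivity)]
    nth_rewrite 2 [← Real.rpow_one ‖T x‖]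
    rw [← Real.rpow_add_of_nonneg (norm_nonneg _) (by linarith) zero_le_one]
    congr 1
    ring
  rw [← ofReal_norm, h, ← ENNReal.ofReal_rpow_of_nonneg (norm_nonneg _) (by linarith),
    ofReal_norm]

section Synthesis
variable {M ι : Type*} [MeasurableSpace M] {μ : Measure M}

theorem memLp_ofReal_of_memLp_two_of_memLp_top {f : M → ℂ} (h2 : MemLp f 2 μ) (ht : MemLp f ⊤ μ)
    {q : ℝ} (hq : 2 ≤ q) : MemLp f (ENNReal.ofReal q) μ := by
  refine ⟨h2.1, ?_⟩
  have hq0 : 0 < q := by linarith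
  rw [eLpNorm_lt_top_iff_lintegral_rpow_enorm_lt_top (by simpa using hq0) (by simp),
    ENNReal.toReal_ofReal hq0.le]
  calc ∫⁻ x, ‖f x‖ₑ ^ q ∂μ ≤ ∫⁻ x, eLpNorm f ⊤ μ ^ (q - 2) * ‖f x‖ₑ ^ 2 ∂μ := by
        refine lintegral_mono_ae ?_
        filter_upwards [enorm_ae_le_eLpNormEssSup f μ] with x hx
        have : ‖f x‖ₑ ^ q = ‖f x‖ₑ ^ (q - 2) * ‖f x‖ₑ ^ 2 := by
          rw [← ENNReal.rpow_natCast,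
            ← ENNReal.rpow_add_of_nonneg _ _ (by linarith) (by positivity)]
          congr 1
          push_cast
          ring
        rw [this, eLpNorm_exponent_top]
        gcongr
    _ = eLpNorm f ⊤ μ ^ (q - 2) * eLpNorm f 2 μ ^ 2 := by
        rw [lintegral_const_mul'' _ (h2.1.enorm.pow_const 2), eLpNorm_two_sq]
    _ < ⊤ := ENNReal.mul_lt_top (ENNReal.rpow_lt_top_of_nonneg (by linarith) ht.eLpNorm_ne_top)
        (ENNReal.pow_lt_top h2.eLpNorm_lt_top)

theorem aestronglyMeasurable_dualFunction {q : ℝ} (hq : 2 ≤ q) {T : M → ℂ}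
    (hT : AEStronglyMeasurable T μ) : AEStronglyMeasurable (dualFunction q T) μ := by
  have hc : Continuous fun z : ℂ ↦ ((‖z‖ ^ (q - 2) : ℝ) : ℂ) * z :=
    (Complex.continuous_ofReal.comp (continuous_norm.rpow_const fun _ ↦ Or.inr (by linarith))).mul
      continuous_id
  exact hc.comp_aestronglyMeasurable hT

theorem eLpNorm_dualFunction {p q : ℝ} (hpq : p.HolderConjugate q) (hq : 2 ≤ q) (T : M → ℂ) :
    eLpNorm (dualFunction q T) (ENNReal.ofReal p) μ =
      eLpNorm T (ENNReal.ofReal q) μ ^ (q - 1) := by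
  have hp0 := hpq.pos
  have hq0 := hpq.symm.pos
  rw [eLpNorm_eq_lintegral_rpow_enorm_toReal (by simpa using hp0) (by simp),
    ENNReal.toReal_ofReal hp0.le]
  simp_rw [enorm_dualFunction hq, ← ENNReal.rpow_mul]
  rw [hpq.symm.sub_one_mul_conj, lintegral_enorm_rpow_eq hq0, ← ENNReal.rpow_mul]
  congr 1
  nth_rewrite 1 [← hpq.symm.sub_one_mul_conj]
  field_simp

/-- The norm of a function in `L^q` is attained on the extremal function of Hölder's inequality. -/
theorem enorm_integral_mul_conj_dualFunction {q : ℝ} (hq : 2 ≤ q) {T : M → ℂ}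
    (hT : MemLp T (ENNReal.ofReal q) μ) :
    ‖∫ x, T x * conj (dualFunction q T x) ∂μ‖ₑ = eLpNorm T (ENNReal.ofReal q) μ ^ q := by
  have hq0 : 0 < q := by linarith
  have hint : Integrable (fun x ↦ ‖T x‖ ^ q) μ := by
    have := hT.integrable_norm_rpow (by simpa using hq0) (by simp)
    rwa [ENNReal.toReal_ofReal hq0.le] at this
  simp_rw [mul_conj_dualFunction hq]
  rw [integral_complex_ofReal, ← ofReal_norm, Complex.norm_real, Real.norm_of_nonneg (integral_nonneg fun x ↦ by positivity),
    ofReal_integral_eq_lintegral_ofReal hint (.of_forall fun x ↦ by positivity),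
    ← lintegral_enorm_rpow_eq hq0]
  refine lintegral_congr fun x ↦ ?_
  rw [← ENNReal.ofReal_rpow_of_nonneg (norm_nonneg _) hq0.le, ofReal_norm]

theorem conj_lFourier (v : ι → Lp ℂ 2 μ) (g : M → ℂ) (ξ : ι) :
    conj (lFourier μ v g ξ) = ∫ x, v ξ x * conj (g x) ∂μ := by
  rw [lFourier, ← integral_conj]
  simp [mul_comm]

theorem ENNReal.sum_mul_sq_le (S : Finset ι) (a b : ι → ℝ≥0∞) :
    (∑ ξ ∈ S, a ξ * b ξ) ^ 2 ≤ (∑ ξ ∈ S, a ξ ^ 2) * ∑ ξ ∈ S, b ξ ^ 2 := by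
  have h := ENNReal.inner_le_Lp_mul_Lq S a b Real.HolderConjugate.two_two
  simp only [ENNReal.rpow_two] at h
  calc _ ≤ _ := pow_le_pow_left' h 2
    _ = _ := by
      rw [mul_pow, ← ENNReal.rpow_natCast, ← ENNReal.rpow_natCast, ← ENNReal.rpow_mul,
        ← ENNReal.rpow_mul]
      simp

/-- The synthesis estimate, dual to the weighted Bessel inequality. -/
theorem IsBoundedBessel.exists_eLpNorm_sum_le {v : ι → Lp ℂ 2 μ} {w : ι → ℝ≥0∞}
    {K : ℝ≥0} (hv : IsBoundedBessel v w K) {p q : ℝ} (hpq : p.HolderConjugate q) (hp2 : p ≤ 2)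
    (hq : 2 ≤ q) :
    ∃ C : ℝ≥0, ∀ h : ι → ℝ≥0, (p < 2 → IsWeakSummable w h) → ∀ (S : Finset ι) (d : ι → ℂ),
      eLpNorm (fun x ↦ ∑ ξ ∈ S, d ξ * ((h ξ ^ (1 / p - 1 / 2) : ℝ≥0) : ℂ) * v ξ x)
        (ENNReal.ofReal q) μ ^ 2 ≤ C ^ 2 * ∑ ξ ∈ S, ‖d ξ‖ₑ ^ 2 := by
  have hγ : 0 ≤ 1 / p - 1 / 2 := sub_nonneg.2 (one_div_le_one_div_of_le hpq.pos hp2)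
  obtain ⟨C, hC⟩ := hv.exists_tsum_rpow_le hpq.lt hp2
  refine ⟨C, fun h hh S d ↦ ?_⟩
  set T : M → ℂ := fun x ↦ ∑ ξ ∈ S, d ξ * ((h ξ ^ (1 / p - 1 / 2) : ℝ≥0) : ℂ) * v ξ x with hTdef
  have hT : MemLp T (ENNReal.ofReal q) μ := by
    refine memLp_finsetSum S fun ξ _ ↦ ?_
    exact (memLp_ofReal_of_memLp_two_of_memLp_top (Lp.memLp _) (hv.memLp_top ξ) hq).const_mul _
  set N := eLpNorm T (ENNReal.ofReal q) μ with hN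
  set g := dualFunction q T with hg
  have hgN : eLpNorm g (ENNReal.ofReal p) μ = N ^ (q - 1) := eLpNorm_dualFunction hpq hq T
  have hgm : MemLp g (ENNReal.ofReal p) μ := by
    refine ⟨aestronglyMeasurable_dualFunction hq hT.1, ?_⟩
    rw [hgN]
    exact ENNReal.rpow_lt_top_of_nonneg (by linarith) hT.eLpNorm_ne_top
  have hpair : ∫ x, T x * conj (g x) ∂μ =
      ∑ ξ ∈ S, d ξ * ((h ξ ^ (1 / p - 1 / 2) : ℝ≥0) : ℂ) * conj (lFourier μ v g ξ) := by
    simp_rw [hTdef, Finset.sum_mul]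
    rw [integral_finsetSum]
    · refine Finset.sum_congr rfl fun ξ _ ↦ ?_
      simp_rw [conj_lFourier, mul_assoc, integral_const_mul]
    · intro ξ _
      have hi := (LinearIsometryEquiv.integrable_comp_iff Complex.conjLIE).2
        (hv.integrable_mul_conj hpq.lt hp2 hgm ξ)
      simp_rw [mul_assoc]
      refine ((hi.const_mul ((h ξ ^ (1 / p - 1 / 2) : ℝ≥0) : ℂ)).const_mul (d ξ)).congr ?_
      filter_upwards with x
      simp [mul_comm]
  -- Pairing `T` with its extremal function gives `N ^ q ≤ C ‖d‖ N ^ (q - 1)`; the power of `N` on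
  -- the right is cancelled at the end, for which `N` has to be nonzero and finite.
  rcases eq_or_ne N 0 with h0 | h0
  · simp [h0]
  have hNt : N ≠ ⊤ := hT.eLpNorm_ne_top
  have hle : (N ^ q) ^ 2 ≤ (C ^ 2 * ∑ ξ ∈ S, ‖d ξ‖ₑ ^ 2) * (N ^ (q - 1)) ^ 2 := by
    calc (N ^ q) ^ 2
        ≤ (∑ ξ ∈ S, ‖d ξ‖ₑ * (‖lFourier μ v g ξ‖ₑ * (h ξ : ℝ≥0∞) ^ (1 / p - 1 / 2))) ^ 2 := by
          rw [← enorm_integral_mul_conj_dualFunction hq hT, hpair]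
          gcongr
          refine (enorm_sum_le _ _).trans (Finset.sum_le_sum fun ξ _ ↦ le_of_eq ?_)
          rw [enorm_mul, enorm_mul, RCLike.enorm_conj, mul_assoc,
            mul_comm (‖lFourier μ v g ξ‖ₑ), ← ENNReal.coe_rpow_of_nonneg _ hγ]
          rw [enorm_coe_nnreal_complex]
      _ ≤ (∑ ξ ∈ S, ‖d ξ‖ₑ ^ 2) *
            ∑ ξ ∈ S, (‖lFourier μ v g ξ‖ₑ * (h ξ : ℝ≥0∞) ^ (1 / p - 1 / 2)) ^ 2 :=
          ENNReal.sum_mul_sq_le _ _ _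
      _ ≤ (∑ ξ ∈ S, ‖d ξ‖ₑ ^ 2) * (C * N ^ (q - 1)) ^ 2 := by
          gcongr
          rw [← hgN]
          refine le_trans ?_ (hC h hh g hgm)
          refine le_trans (le_of_eq (Finset.sum_congr rfl fun ξ _ ↦ ?_)) (ENNReal.sum_le_tsum S)
          rw [mul_pow, ← ENNReal.rpow_natCast (_ ^ (_ : ℝ)), ← ENNReal.rpow_mul]
          congr 2
          push_cast
          ring
      _ = _ := by ring
  have hsplit : (N ^ q) ^ 2 = N ^ 2 * (N ^ (q - 1)) ^ 2 := by
    rw [← mul_pow]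
    nth_rewrite 2 [← ENNReal.rpow_one N]
    rw [← ENNReal.rpow_add _ _ h0 hNt]
    congr 2
    ring
  rw [hsplit] at hle
  refine (ENNReal.mul_le_mul_iff_left ?_ ?_).1 hle
  · simp [ENNReal.rpow_eq_zero_iff, h0, hNt]
  · exact ENNReal.pow_ne_top (ENNReal.rpow_ne_top_of_ne_zero h0 hNt)

end Synthesis

/-! ### Unconditional convergence -/

/-- A series whose finite partial sums are dominated by `ℓ²` norms of square summable coefficients
converges unconditionally. -/
theorem summable_and_norm_tsum_le_of_sum_sq_le {ι E : Type*} [NormedAddCommGroup E]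
    [CompleteSpace E] {x : ι → E} {d : ι → ℝ} {C D : ℝ} (hC : 0 ≤ C) (hD : 0 ≤ D)
    (hx : ∀ S : Finset ι, ‖∑ ξ ∈ S, x ξ‖ ^ 2 ≤ C ^ 2 * ∑ ξ ∈ S, d ξ ^ 2)
    (hd : ∀ S : Finset ι, ∑ ξ ∈ S, d ξ ^ 2 ≤ D ^ 2) :
    Summable x ∧ ‖∑' ξ, x ξ‖ ≤ C * D := by
  have hsum : Summable x := by
    have hds : Summable fun ξ ↦ d ξ ^ 2 := summable_of_sum_le (fun ξ ↦ sq_nonneg _) hd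
    rw [summable_iff_vanishing_norm] at hds ⊢
    intro ε hε
    obtain ⟨S, hS⟩ := hds ((ε / (C + 1)) ^ 2) (by positivity)
    refine ⟨S, fun t ht ↦ ?_⟩
    have h1 := hS t ht
    rw [Real.norm_of_nonneg (Finset.sum_nonneg fun _ _ ↦ sq_nonneg _)] at h1
    refine lt_of_pow_lt_pow_left₀ 2 hε.le ?_
    calc _ ≤ C ^ 2 * ∑ ξ ∈ t, d ξ ^ 2 := hx t
      _ ≤ (C + 1) ^ 2 * ∑ ξ ∈ t, d ξ ^ 2 := by
          gcongr
          linarith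
      _ < (C + 1) ^ 2 * (ε / (C + 1)) ^ 2 := by gcongr
      _ = ε ^ 2 := by field_simp
  refine ⟨hsum, le_of_tendsto hsum.hasSum.norm (.of_forall fun S ↦ ?_)⟩
  refine (sq_le_sq₀ (norm_nonneg _) (by positivity)).1 ?_
  rw [mul_pow]
  exact (hx S).trans (by gcongr; exact hd S)

/-! ### Riesz bases and biorthogonal systems -/

section Riesz
variable {ι H : Type*} [NormedAddCommGroup H] [InnerProductSpace ℂ H] [CompleteSpace H]

theorem HilbertBasis.tsum_enorm_inner_apply_le (e : HilbertBasis ι ℂ H) (T : H →L[ℂ] H) (f : H) :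
    ∑' ξ, ‖inner ℂ (T (e ξ)) f‖ₑ ^ 2 ≤ (‖T‖₊ ^ 2 : ℝ≥0) * ‖f‖ₑ ^ 2 := by
  have hs : ∑' ξ, ‖inner ℂ (e ξ) (T.adjoint f)‖ ^ 2 ≤ ‖T.adjoint f‖ ^ 2 :=
    e.orthonormal.tsum_inner_products_le _
  have h : ∑' ξ, ‖inner ℂ (T (e ξ)) f‖ₑ ^ 2 ≤ ‖T.adjoint f‖ₑ ^ 2 := by
    simp_rw [← ofReal_norm, ← ENNReal.ofReal_pow (norm_nonneg _),
      ← ContinuousLinearMap.adjoint_inner_right]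
    rw [← ENNReal.ofReal_tsum_of_nonneg (fun _ ↦ by positivity)
      (e.orthonormal.inner_products_summable _)]
    exact ENNReal.ofReal_le_ofReal hs
  refine h.trans ?_
  rw [ENNReal.coe_pow, ← mul_pow]
  gcongr
  have := T.adjoint.le_opENorm f
  refine this.trans (le_of_eq ?_)
  congr 1
  rw [← ofReal_norm, LinearIsometryEquiv.norm_map, ofReal_norm]
  rfl

/-- A system biorthogonal to the image of an orthonormal basis under `T` is its image under the
inverse adjoint of `T`. -/
theorem eq_adjoint_symm_of_biorthogonal (e : HilbertBasis ι ℂ H) (T : H ≃L[ℂ] H) {v : ι → H}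
    (h1 : ∀ ξ, inner ℂ (v ξ) (T (e ξ)) = 1)
    (h0 : ∀ ξ η, ξ ≠ η → inner ℂ (v η) (T (e ξ)) = 0) (η : ι) :
    v η = (T.symm : H →L[ℂ] H).adjoint (e η) := by
  classical
  have key : (T : H →L[ℂ] H).adjoint (v η) = e η := by
    refine e.repr.injective ?_
    ext ξ
    rw [e.repr_apply_apply, e.repr_apply_apply, ContinuousLinearMap.adjoint_inner_right,
      ← inner_conj_symm, ContinuousLinearEquiv.coe_coe, orthonormal_iff_ite.1 e.orthonormal]
    split_ifs with h
    · subst h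
      rw [h1, map_one]
    · rw [h0 ξ η h, map_zero]
  rw [← key]
  refine ext_inner_right ℂ fun y ↦ ?_
  simp [ContinuousLinearMap.adjoint_inner_left]

theorem hasSum_inner_smul_of_biorthogonal (e : HilbertBasis ι ℂ H) (T : H ≃L[ℂ] H) {v : ι → H}
    (hv : ∀ ξ, v ξ = (T.symm : H →L[ℂ] H).adjoint (e ξ)) (f : H) :
    HasSum (fun ξ ↦ inner ℂ (v ξ) f • T (e ξ)) f := by
  have h := (e.hasSum_repr (T.symm f)).mapL (T : H →L[ℂ] H)
  simpa [e.repr_apply_apply, hv, ContinuousLinearMap.adjoint_inner_left] using h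

end Riesz

/-! ### The multiplier from `L^p` to `L^q` -/

section Multiplier
variable {M ι : Type*} [MeasurableSpace M] {μ : Measure M}

/-- A bounded multiple of `h ^ (1 / p - 1 / q)` is a multiplier from `L^p` to `L^q`. The weight is
split as `h ^ (1 / p - 1 / 2) * h ^ (1 / 2 - 1 / q)`; the first factor makes the coefficients
square summable and the second one is absorbed by the synthesis estimate. -/
theorem exists_multiplier {u v : ι → Lp ℂ 2 μ} {w : ι → ℝ≥0∞} {K : ℝ≥0}
    (hu : IsBoundedBessel u w K) (hv : IsBoundedBessel v w K)
    {p q : ℝ≥0∞} [Fact (1 ≤ p)] [Fact (1 ≤ q)]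
    (hp1 : 1 < p) (hp2 : p ≤ 2) (hq2 : 2 ≤ q) (hq : q < ⊤) (hU : ∀ ξ, MemLp (u ξ) q μ) :
    ∃ C : ℝ≥0, ∀ (h : ι → ℝ≥0) (m : ι → ℂ) (W : ℝ≥0),
      (0 < 1 / p.toReal - 1 / q.toReal → IsWeakSummable w h) → (∀ ξ, ‖m ξ‖ₑ ≤ W) →
      ∃ B : Lp ℂ p μ →L[ℂ] Lp ℂ q μ, ‖B‖ ≤ C * W ∧
        ∀ f : Lp ℂ p μ, HasSum (fun ξ ↦
          (m ξ * ((h ξ ^ (1 / p.toReal - 1 / q.toReal) : ℝ≥0) : ℂ) * lFourier μ v f ξ) •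
            (hU ξ).toLp (u ξ)) (B f) := by
  have hpt : p ≠ ⊤ := (hp2.trans_lt (by simp)).ne
  have hpe : ENNReal.ofReal p.toReal = p := ENNReal.ofReal_toReal hpt
  have hqe : ENNReal.ofReal q.toReal = q := ENNReal.ofReal_toReal hq.ne
  have hp1' : 1 < p.toReal := by
    simpa using (ENNReal.toReal_lt_toReal (by simp) hpt).2 hp1
  have hp2' : p.toReal ≤ 2 := by
    simpa using (ENNReal.toReal_le_toReal hpt (by simp)).2 hp2
  have hq2' : 2 ≤ q.toReal := by
    simpa using (ENNReal.toReal_le_toReal (by simp) hq.ne).2 hq2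
  -- The exponent conjugate to `q`.
  set r := q.toReal.conjExponent with hr
  have hrq : r.HolderConjugate q.toReal :=
    (Real.HolderConjugate.conjExponent (by linarith)).symm
  have hinv : 1 / r = 1 - 1 / q.toReal := by
    rw [one_div, one_div]
    linarith [hrq.inv_add_inv_eq_one]
  have hqi : 1 / q.toReal ≤ 1 / 2 := one_div_le_one_div_of_le (by norm_num) hq2'
  have hpi : 1 / 2 ≤ 1 / p.toReal := one_div_le_one_div_of_le (by linarith) hp2'
  have hr2 : r ≤ 2 := by
    rw [← one_div_le_one_div (by norm_num) hrq.pos, hinv]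
    linarith
  obtain ⟨C₁, hC₁⟩ := hv.exists_tsum_rpow_le hp1' hp2'
  obtain ⟨C₂, hC₂⟩ := hu.exists_eLpNorm_sum_le hrq hr2 hq2'
  rw [hpe] at hC₁
  rw [hqe] at hC₂
  refine ⟨C₂ * C₁, fun h m W hh hm ↦ ?_⟩
  have hhp : p.toReal < 2 → IsWeakSummable w h := fun hlt ↦ hh <| by
    have : 1 / 2 < 1 / p.toReal := one_div_lt_one_div_of_lt (by linarith) hlt
    linarith
  have hhr : r < 2 → IsWeakSummable w h := fun hlt ↦ hh <| by
    have : 1 / 2 < 1 / r := one_div_lt_one_div_of_lt hrq.pos hlt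
    linarith
  -- `d f` is the square summable sequence of coefficients, `x f` the series defining the operator.
  set d : Lp ℂ p μ → ι → ℂ := fun f ξ ↦
    m ξ * ((h ξ ^ (1 / p.toReal - 1 / 2) : ℝ≥0) : ℂ) * lFourier μ v f ξ with hd
  set x : Lp ℂ p μ → ι → Lp ℂ q μ := fun f ξ ↦
    (m ξ * ((h ξ ^ (1 / p.toReal - 1 / q.toReal) : ℝ≥0) : ℂ) * lFourier μ v f ξ) •
      (hU ξ).toLp (u ξ) with hx
  have hfactor (ξ : ι) : h ξ ^ (1 / p.toReal - 1 / q.toReal) =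
      h ξ ^ (1 / p.toReal - 1 / 2) * h ξ ^ (1 / r - 1 / 2) := by
    rw [← NNReal.rpow_add_of_nonneg _ (by linarith) (by linarith)]
    congr 1
    linarith
  have hdsum (f : Lp ℂ p μ) (S : Finset ι) :
      ∑ ξ ∈ S, ‖d f ξ‖ₑ ^ 2 ≤ (W * (C₁ * ‖f‖ₑ)) ^ 2 := by
    calc ∑ ξ ∈ S, ‖d f ξ‖ₑ ^ 2
        ≤ ∑ ξ ∈ S, W ^ 2 * (‖lFourier μ v f ξ‖ₑ ^ 2 * (h ξ : ℝ≥0∞) ^ (2 / p.toReal - 1)) := by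
          refine Finset.sum_le_sum fun ξ _ ↦ ?_
          rw [hd, enorm_mul, enorm_mul, enorm_coe_nnreal_complex,
            ENNReal.coe_rpow_of_nonneg _ (by linarith), mul_pow, mul_pow, mul_assoc,
            mul_comm (_ ^ 2) (‖lFourier μ v f ξ‖ₑ ^ 2), ← ENNReal.rpow_natCast (_ ^ (_ : ℝ)),
            ← ENNReal.rpow_mul]
          have he : (1 / p.toReal - 1 / 2) * ((2 : ℕ) : ℝ) = 2 / p.toReal - 1 := by
            push_cast
            ring
          rw [he]
          gcongr
          exact hm ξ
      _ ≤ W ^ 2 * (C₁ * ‖f‖ₑ) ^ 2 := by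
          rw [← Finset.mul_sum, Lp.enorm_def]
          gcongr
          exact (ENNReal.sum_le_tsum S).trans (hC₁ h hhp f (Lp.memLp f))
      _ = _ := by ring
  have hxsum (f : Lp ℂ p μ) (S : Finset ι) :
      ‖∑ ξ ∈ S, x f ξ‖ₑ ^ 2 ≤ C₂ ^ 2 * ∑ ξ ∈ S, ‖d f ξ‖ₑ ^ 2 := by
    refine le_trans (le_of_eq ?_) (hC₂ h hhr S (d f))
    rw [Lp.enorm_def]
    congr 1
    refine eLpNorm_congr_ae ?_
    have hall : ∀ᵐ y ∂μ, ∀ ξ ∈ S, x f ξ y =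
        d f ξ * ((h ξ ^ (1 / r - 1 / 2) : ℝ≥0) : ℂ) * u ξ y := by
      refine (Finset.eventually_all S).2 fun ξ _ ↦ ?_
      filter_upwards [Lp.coeFn_smul (m ξ * ((h ξ ^ (1 / p.toReal - 1 / q.toReal) : ℝ≥0) : ℂ) *
        lFourier μ v f ξ) ((hU ξ).toLp (u ξ)), (hU ξ).coeFn_toLp] with y hy1 hy2
      rw [hx, hy1, Pi.smul_apply, hy2, smul_eq_mul, hd, hfactor]
      push_cast
      ring
    filter_upwards [hall, Lp.coeFn_finsetSum S (x f)] with y hy1 hy2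
    rw [hy2, Finset.sum_apply]
    exact Finset.sum_congr rfl hy1
  have hmain (f : Lp ℂ p μ) : Summable (x f) ∧ ‖∑' ξ, x f ξ‖ ≤ C₂ * (W * (C₁ * ‖f‖)) := by
    refine summable_and_norm_tsum_le_of_sum_sq_le (d := fun ξ ↦ ‖d f ξ‖) C₂.2 (by positivity)
      (fun S ↦ ?_) (fun S ↦ ?_)
    · have h1 := hxsum f S
      simp only [enorm_eq_nnnorm] at h1
      have h2 : ‖∑ ξ ∈ S, x f ξ‖₊ ^ 2 ≤ C₂ ^ 2 * ∑ ξ ∈ S, ‖d f ξ‖₊ ^ 2 := by exact_mod_cast h1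
      simpa using NNReal.coe_le_coe.2 h2
    · have h1 := hdsum f S
      simp only [enorm_eq_nnnorm] at h1
      have h2 : ∑ ξ ∈ S, ‖d f ξ‖₊ ^ 2 ≤ (W * (C₁ * ‖f‖₊)) ^ 2 := by exact_mod_cast h1
      simpa using NNReal.coe_le_coe.2 h2
  have hadd (f g : Lp ℂ p μ) (ξ : ι) : x (f + g) ξ = x f ξ + x g ξ := by
    have hi (f : Lp ℂ p μ) : Integrable (fun y ↦ f y * conj (v ξ y)) μ :=
      hv.integrable_mul_conj hp1' hp2' (by rw [hpe]; exact Lp.memLp f) ξ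
    have : lFourier μ v ((f + g : Lp ℂ p μ) : M → ℂ) ξ = lFourier μ v f ξ + lFourier μ v g ξ := by
      rw [lFourier_congr_ae v (Lp.coeFn_add f g), lFourier, lFourier, lFourier,
        ← integral_add (hi f) (hi g)]
      simp [add_mul]
    simp only [hx, this, mul_add, add_smul]
  have hsmul (c : ℂ) (f : Lp ℂ p μ) (ξ : ι) : x (c • f) ξ = c • x f ξ := by
    have : lFourier μ v ((c • f : Lp ℂ p μ) : M → ℂ) ξ = c * lFourier μ v f ξ := by
      rw [lFourier_congr_ae v (Lp.coeFn_smul c f), ← lFourier_const_mul]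
      rfl
    simp only [hx, this, smul_smul]
    congr 1
    ring
  let B₀ : Lp ℂ p μ →ₗ[ℂ] Lp ℂ q μ :=
    { toFun := fun f ↦ ∑' ξ, x f ξ
      map_add' := fun f g ↦ by
        simp_rw [hadd]
        exact (hmain f).1.tsum_add (hmain g).1
      map_smul' := fun c f ↦ by
        simp_rw [hsmul]
        exact (hmain f).1.tsum_const_smul c }
  have hB₀ (f : Lp ℂ p μ) : ‖B₀ f‖ ≤ (C₂ * C₁ * W : ℝ) * ‖f‖ :=
    (hmain f).2.trans (le_of_eq (by ring))
  refine ⟨B₀.mkContinuous _ hB₀, ?_, fun f ↦ (hmain f).1.hasSum⟩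
  have := B₀.mkContinuous_norm_le (by positivity) hB₀
  simpa using this

end Multiplier

/-! ### Factorization of the symbol -/

section Symbol
variable {M ι : Type*} [MeasurableSpace M] {μ : Measure M} {u v : ι → Lp ℂ 2 μ}

/-- The weight attached to an index: the larger of the two sup-norms. -/
noncomputable def supWeight (u v : ι → Lp ℂ 2 μ) (ξ : ι) : ℝ≥0∞ :=
  max (eLpNorm (u ξ) ⊤ μ) (eLpNorm (v ξ) ⊤ μ)

theorem supWeight_sq (ξ : ι) :
    supWeight u v ξ ^ 2 = max (eLpNorm (u ξ) ⊤ μ ^ 2) (eLpNorm (v ξ) ⊤ μ ^ 2) :=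
  (pow_left_mono 2).map_max

theorem mul_rpow_le_symbolWeakNorm (σ : ι → ℂ) (r : ℝ) {s : ℝ} (hs : 0 < s)
    (hex : ∃ ξ, s ≤ ‖σ ξ‖) :
    ENNReal.ofReal s * (∑' ξ, {ξ | s ≤ ‖σ ξ‖}.indicator (fun ξ ↦ supWeight u v ξ ^ 2) ξ) ^ r ≤
      symbolWeakNorm u v σ r := by
  refine le_trans (le_of_eq ?_) (le_iSup₂_of_le s hs (le_iSup_of_le hex le_rfl))
  rw [← tsum_subtype]
  simp_rw [supWeight_sq]
  rfl

/-- The symbol is a bounded multiple of a power of a function in weak `ℓ¹`; this is where the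
weak-type quantity enters. For exponent `0` the function `1` serves. -/
theorem exists_symbol_factorization (σ : ι → ℂ) {r : ℝ} (hr : 0 ≤ r) (hu : ∀ ξ, u ξ ≠ 0)
    (hW : symbolWeakNorm u v σ r < ⊤) :
    ∃ (h : ι → ℝ≥0) (m : ι → ℂ), (0 < r → IsWeakSummable (supWeight u v) h) ∧
      (∀ ξ, ‖m ξ‖ₑ ≤ symbolWeakNorm u v σ r) ∧ ∀ ξ, σ ξ = m ξ * ((h ξ ^ r : ℝ≥0) : ℂ) := by
  rcases hr.eq_or_lt with rfl | hr
  · refine ⟨fun _ ↦ 1, σ, fun h ↦ absurd h (lt_irrefl _), fun ξ ↦ ?_, fun ξ ↦ by simp⟩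
    rcases eq_or_ne (σ ξ) 0 with h0 | h0
    · simp [h0]
    · simpa [ofReal_norm] using
        mul_rpow_le_symbolWeakNorm (u := u) (v := v) σ 0 (norm_pos_iff.2 h0) ⟨ξ, le_rfl⟩
  set V := (symbolWeakNorm u v σ r).toNNReal with hV
  have hVW : (V : ℝ≥0∞) = symbolWeakNorm u v σ r := ENNReal.coe_toNNReal hW.ne
  -- If `V = 0`, then `σ = 0` because all weights are positive, and the quotients by `V` below take
  -- the value `0` by convention, as they should.
  have hV0 (ξ : ι) (hξ : σ ξ ≠ 0) : V ≠ 0 := by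
    intro h0
    have h1 := mul_rpow_le_symbolWeakNorm (u := u) (v := v) σ r (norm_pos_iff.2 hξ) ⟨ξ, le_rfl⟩
    rw [← hVW, h0, ENNReal.coe_zero, nonpos_iff_eq_zero, mul_eq_zero] at h1
    rcases h1 with h1 | h1
    · simp [hξ] at h1
    · rw [ENNReal.rpow_eq_zero_iff_of_pos hr, ENNReal.tsum_eq_zero] at h1
      have h2 := h1 ξ
      rw [Set.indicator_of_mem (by simp)] at h2
      have h3 : eLpNorm (u ξ) ⊤ μ = 0 := by
        have : supWeight u v ξ = 0 := by simpa using h2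
        exact le_antisymm (this ▸ le_max_left _ _) zero_le
      rw [eLpNorm_eq_zero_iff (Lp.aestronglyMeasurable _) (by simp)] at h3
      exact hu ξ ((Lp.eq_zero_iff_ae_eq_zero).2 h3)
  have hpow (ξ : ι) : ((‖σ ξ‖₊ / V) ^ (1 / r)) ^ r = ‖σ ξ‖₊ / V := by
    rw [← NNReal.rpow_mul, one_div_mul_cancel hr.ne', NNReal.rpow_one]
  refine ⟨fun ξ ↦ (‖σ ξ‖₊ / V) ^ (1 / r), fun ξ ↦ σ ξ / ((‖σ ξ‖₊ / V : ℝ≥0) : ℂ),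
    fun _ k ↦ ?_, fun ξ ↦ ?_, fun ξ ↦ ?_⟩
  · have hset (ξ : ι) : (2 : ℝ≥0∞) ^ (k : ℝ) ≤ (((‖σ ξ‖₊ / V) ^ (1 / r) : ℝ≥0) : ℝ≥0∞) ↔
        V ≠ 0 ∧ (V : ℝ) * 2 ^ ((k : ℝ) * r) ≤ ‖σ ξ‖ := by
      have h2 : (2 : ℝ≥0∞) ^ (k : ℝ) = (((2 : ℝ≥0) ^ (k : ℝ) : ℝ≥0) : ℝ≥0∞) := by
        rw [ENNReal.coe_rpow_of_ne_zero (by simp)]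
        simp
      rw [h2, ENNReal.coe_le_coe, ← NNReal.rpow_le_rpow_iff hr, hpow, ← NNReal.rpow_mul]
      rcases eq_or_ne V 0 with h0 | h0
      · simp [h0]
      · rw [le_div_iff₀ (pos_iff_ne_zero.2 h0), ← NNReal.coe_le_coe]
        simp [h0, mul_comm]
    by_cases hex : ∃ ξ, (2 : ℝ≥0∞) ^ (k : ℝ) ≤ (((‖σ ξ‖₊ / V) ^ (1 / r) : ℝ≥0) : ℝ≥0∞)
    · obtain ⟨ξ₀, hξ₀⟩ := hex
      have hVne := ((hset ξ₀).1 hξ₀).1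
      have hVp : (0 : ℝ) < V := by exact_mod_cast pos_iff_ne_zero.2 hVne
      have h1 := mul_rpow_le_symbolWeakNorm (u := u) (v := v) σ r
        (s := (V : ℝ) * 2 ^ ((k : ℝ) * r)) (by positivity) ⟨ξ₀, ((hset ξ₀).1 hξ₀).2⟩
      set A := ∑' ξ, (if (2 : ℝ≥0∞) ^ (k : ℝ) ≤ (((‖σ ξ‖₊ / V) ^ (1 / r) : ℝ≥0) : ℝ≥0∞) then
        supWeight u v ξ ^ 2 else 0) with hA
      have hA' : ∑' ξ, {ξ | (V : ℝ) * 2 ^ ((k : ℝ) * r) ≤ ‖σ ξ‖}.indicator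
          (fun ξ ↦ supWeight u v ξ ^ 2) ξ = A := by
        refine tsum_congr fun ξ ↦ ?_
        simp only [Set.indicator_apply, Set.mem_ofPred_eq, hset ξ, hVne, ne_eq, not_false_eq_true,
          true_and]
      rw [hA', ← hVW, ENNReal.ofReal_mul hVp.le, ENNReal.ofReal_coe_nnreal, mul_assoc] at h1
      have h2 : ENNReal.ofReal (2 ^ ((k : ℝ) * r)) * A ^ r ≤ 1 := by
        refine (ENNReal.mul_le_mul_iff_right (a := (V : ℝ≥0∞)) (by simpa using hVne)
          ENNReal.coe_ne_top).1 ?_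
        rwa [mul_one]
      rw [← ENNReal.ofReal_rpow_of_pos (by norm_num), ENNReal.rpow_mul,
        ← ENNReal.mul_rpow_of_nonneg _ _ hr.le] at h2
      have h3 := (ENNReal.rpow_le_rpow_iff hr).1 (h2.trans_eq (ENNReal.one_rpow r).symm)
      rw [ENNReal.rpow_neg, ENNReal.le_inv_iff_mul_le, mul_comm]
      simpa using h3
    · push Not at hex
      have (ξ : ι) : (if (2 : ℝ≥0∞) ^ (k : ℝ) ≤ (((‖σ ξ‖₊ / V) ^ (1 / r) : ℝ≥0) : ℝ≥0∞) then
        supWeight u v ξ ^ 2 else 0) = 0 := if_neg (not_le.2 (hex ξ))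
      simp only [this, tsum_zero, zero_le]
  · rcases eq_or_ne (σ ξ) 0 with h0 | h0
    · simp [h0]
    · have hVne := hV0 ξ h0
      rw [← hVW, enorm_eq_nnnorm, ENNReal.coe_le_coe, nnnorm_div]
      refine le_of_eq ?_
      have : ‖((‖σ ξ‖₊ / V : ℝ≥0) : ℂ)‖₊ = ‖σ ξ‖₊ / V := by
        have := enorm_coe_nnreal_complex (‖σ ξ‖₊ / V)
        rwa [enorm_eq_nnnorm, ENNReal.coe_inj] at this
      rw [this, div_div_cancel₀]
      simpa using h0
  · rw [hpow]
    rcases eq_or_ne (σ ξ) 0 with h0 | h0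
    · simp [h0]
    · have hVne := hV0 ξ h0
      rw [div_mul_cancel₀]
      simpa using ⟨h0, hVne⟩

end Symbol

/-! ### Eigenfunction expansions -/

section EigenSystem
variable {M ι : Type*} [MeasurableSpace M] {μ : Measure M} {L : Lp ℂ 2 μ →ₗ.[ℂ] Lp ℂ 2 μ}
  {lam : ι → ℂ} {u v : ι → Lp ℂ 2 μ}

theorem IsEigenSystem.inner_self (hsys : IsEigenSystem μ L lam u v) (ξ : ι) :
    inner ℂ (v ξ) (u ξ) = 1 := by
  rw [← lFourier_eq_inner]
  exact hsys.biorthogonal_self ξ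

theorem IsEigenSystem.inner_ne (hsys : IsEigenSystem μ L lam u v) {ξ η : ι} (h : ξ ≠ η) :
    inner ℂ (v η) (u ξ) = 0 := by
  rw [← lFourier_eq_inner]
  exact hsys.biorthogonal_ne ξ η h

/-- Both families are Bessel systems, and every `L²` function is the sum of its expansion. -/
theorem IsEigenSystem.exists_isBoundedBessel (hsys : IsEigenSystem μ L lam u v)
    (hu : ∀ ξ, MemLp (u ξ) ⊤ μ) (hv : ∀ ξ, MemLp (v ξ) ⊤ μ) :
    (∃ K : ℝ≥0, IsBoundedBessel u (supWeight u v) K ∧ IsBoundedBessel v (supWeight u v) K) ∧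
      ∀ f : Lp ℂ 2 μ, HasSum (fun ξ ↦ (inner ℂ (v ξ) f : ℂ) • u ξ) f := by
  obtain ⟨e, T, hT⟩ := hsys.riesz
  have hve := eq_adjoint_symm_of_biorthogonal e T (v := v)
    (fun ξ ↦ by rw [← hT]; exact hsys.inner_self ξ)
    (fun ξ η h ↦ by rw [← hT]; exact hsys.inner_ne h)
  constructor
  · refine ⟨max (‖(T : Lp ℂ 2 μ →L[ℂ] Lp ℂ 2 μ)‖₊ ^ 2)
      (‖(T.symm : Lp ℂ 2 μ →L[ℂ] Lp ℂ 2 μ).adjoint‖₊ ^ 2),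
      ⟨hu, fun _ ↦ le_max_left _ _, fun f ↦ ?_⟩, ⟨hv, fun _ ↦ le_max_right _ _, fun f ↦ ?_⟩⟩
    · simp_rw [hT]
      refine (e.tsum_enorm_inner_apply_le (T : Lp ℂ 2 μ →L[ℂ] Lp ℂ 2 μ) f).trans ?_
      gcongr
      exact le_max_left _ _
    · simp_rw [hve]
      refine (e.tsum_enorm_inner_apply_le _ f).trans ?_
      gcongr
      exact le_max_right _ _
  · intro f
    simp_rw [hT]
    exact hasSum_inner_smul_of_biorthogonal e T hve f

theorem IsEigenSystem.ne_zero (hsys : IsEigenSystem μ L lam u v) (ξ : ι) : u ξ ≠ 0 := by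
  intro h
  simpa [h] using hsys.inner_self ξ

end EigenSystem

/-! ### The extension theorem -/

/-- If the same series of functions converges in `L^p` and in `L^q`, the sums agree almost
everywhere. -/
theorem ae_eq_of_hasSum_of_hasSum {M ι : Type*} [MeasurableSpace M] {μ : Measure M} [Countable ι]
    {p q : ℝ≥0∞} [Fact (1 ≤ p)] [Fact (1 ≤ q)] {x : ι → Lp ℂ p μ} {y : ι → Lp ℂ q μ}
    {f : Lp ℂ p μ} {g : Lp ℂ q μ} (hx : HasSum x f) (hy : HasSum y g)
    (hxy : ∀ ξ, x ξ =ᵐ[μ] y ξ) : f =ᵐ[μ] g := by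
  refine tendstoInMeasure_ae_unique (u := Filter.atTop)
    ((tendstoInMeasure_of_tendsto_Lp hx).congr_left fun S ↦ ?_) (tendstoInMeasure_of_tendsto_Lp hy)
  filter_upwards [Lp.coeFn_finsetSum S x, Lp.coeFn_finsetSum S y,
    (Finset.eventually_all S).2 fun ξ _ ↦ hxy ξ] with z h1 h2 h3
  rw [h1, h2, Finset.sum_apply, Finset.sum_apply]
  exact Finset.sum_congr rfl h3

theorem mainTheorem7
    {E : Type*} [NormedAddCommGroup E] [NormedSpace ℝ E] [FiniteDimensional ℝ E]
    {H : Type*} [TopologicalSpace H] (I : ModelWithCorners ℝ E H)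
    {M : Type*} [TopologicalSpace M] [ChartedSpace H M] [IsManifold I ∞ M]
    [T2Space M] [SecondCountableTopology M] [MeasurableSpace M] [BorelSpace M]
    (μ : Measure M) [IsLocallyFiniteMeasure μ]
    {ι : Type*} [Countable ι]
    (L : Lp ℂ 2 μ →ₗ.[ℂ] Lp ℂ 2 μ) (lam : ι → ℂ) (u v : ι → Lp ℂ 2 μ)
    (hsys : IsEigenSystem μ L lam u v)
    (hu : ∀ ξ, MemLp (u ξ) ⊤ μ) (hv : ∀ ξ, MemLp (v ξ) ⊤ μ)
    (hvu : (⨆ ξ, eLpNorm (v ξ) ⊤ μ / eLpNorm (u ξ) ⊤ μ) < ⊤)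
    (huv : (⨆ ξ, eLpNorm (u ξ) ⊤ μ / eLpNorm (v ξ) ⊤ μ) < ⊤)
    (p q : ℝ≥0∞) [Fact (1 ≤ p)] [Fact (1 ≤ q)]
    (hp1 : 1 < p) (hp2 : p ≤ 2) (hq2 : 2 ≤ q) (hq : q < ⊤) :
    ∃ C : ℝ≥0, ∀ (A : smoothVectors L →ₗ[ℂ] smoothVectors L) (σ : ι → ℂ),
      IsLFourierMultiplier L v A σ →
      symbolWeakNorm u v σ (1 / p.toReal - 1 / q.toReal) < ⊤ →
      ∃ B : Lp ℂ p μ →L[ℂ] Lp ℂ q μ,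
        (∀ (f : smoothVectors L) (hf : MemLp ((f : Lp ℂ 2 μ) : M → ℂ) p μ),
          B (hf.toLp _) =ᵐ[μ] ((A f : Lp ℂ 2 μ) : M → ℂ)) ∧
        ‖B‖ₑ ≤ C * symbolWeakNorm u v σ (1 / p.toReal - 1 / q.toReal) := by
  obtain ⟨⟨K, hBu, hBv⟩, hexp⟩ := hsys.exists_isBoundedBessel hu hv
  have hU (ξ : ι) : MemLp (u ξ) q μ := by
    rw [← ENNReal.ofReal_toReal hq.ne]
    refine memLp_ofReal_of_memLp_two_of_memLp_top (Lp.memLp _) (hu ξ) ?_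
    simpa using (ENNReal.toReal_le_toReal (by simp) hq.ne).2 hq2
  have hr : 0 ≤ 1 / p.toReal - 1 / q.toReal := by
    have hpt : p ≠ ⊤ := (hp2.trans_lt (by simp)).ne
    refine sub_nonneg.2 (one_div_le_one_div_of_le (ENNReal.toReal_pos (by positivity) hpt) ?_)
    exact (ENNReal.toReal_le_toReal hpt hq.ne).2 (hp2.trans hq2)
  obtain ⟨C, hC⟩ := exists_multiplier hBu hBv hp1 hp2 hq2 hq hU
  refine ⟨C, fun A σ hA hW ↦ ?_⟩
  obtain ⟨h, m, hh, hm, hσ⟩ := exists_symbol_factorization σ hr hsys.ne_zero hW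
  rw [← ENNReal.coe_toNNReal hW.ne] at hm ⊢
  obtain ⟨B, hBn, hB⟩ := hC h m _ hh hm
  refine ⟨B, fun f hf ↦ ?_, ?_⟩
  · refine (ae_eq_of_hasSum_of_hasSum (hexp (A f)) (hB (hf.toLp _)) fun ξ ↦ ?_).symm
    rw [← hσ, lFourier_congr_ae v hf.coeFn_toLp, ← hA f ξ, lFourier_eq_inner]
    filter_upwards [Lp.coeFn_smul (inner ℂ (v ξ) (A f : Lp ℂ 2 μ) : ℂ) (u ξ),
      Lp.coeFn_smul (inner ℂ (v ξ) (A f : Lp ℂ 2 μ) : ℂ) ((hU ξ).toLp (u ξ)),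
      (hU ξ).coeFn_toLp] with z h1 h2 h3
    rw [h1, h2, Pi.smul_apply, Pi.smul_apply, h3]
  · rw [enorm_eq_nnnorm]
    exact_mod_cast hBn
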